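/- Let $N\ge 2$, $m\in\mathbb N$. Let $k_0:[0,\infty)\to[0,\infty]$ be nonincreasing with $$\int_0^\infty \min\{1,r^2\}\,k_0(r)\,r^{N-1}\,dr<\infty ,\qquad \int_0^\infty k_0(r)\,r^{N-1}\,dr=\infty ,$$ and put $k(z)=k_0(|z|)$ for $z\in\mathbb R^N$. For an open set $\Omega\subset\mathbb R^N$ let $$\mathcal E_k(u,v)=\frac12\int_{\mathbb R^N}\int_{\mathbb R^N}(u(x)-u(y))(v(x)-v(y))\,k(x-y)\,dx\,dy ,$$ $$\mathcal D_k(\Omega)=\{u\in L^2(\mathbb R^N):\ u=0 \text{ on }\mathbb R^N\setminus\Omega,\ \mathcal E_k(u,u)<\infty\},$$ and let $I$ be the nonlocal operator associated with $\mathcal E_k$ (formally $Iu(x)=\mathrm{p.v.}\int_{\mathbb R^N}(u(x)-u(y))k(x-y)\,dy$). Let $\Omega\subset\mathbb R^N$ be a bounded radial domain, that is, a nonempty, open, connected, bounded set which is invariant under all rotations about the origin. Let $F=(f_1,\dots,f_m)\in C^1([0,\infty)\times\mathbb R^m,\mathbb R^m)$, $(r,u_1,\dots,u_m)\mapsto F(r,u_1,\dots,u_m)$,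 satisfy $$\frac{\partial f_j}{\partial u_i}\ge 0\quad\text{on }[0,\infty)\times\mathbb R^m\text{ for all } i\ne j .$$ Let $U=(u_1,\dots,u_m):\mathbb R^N\to\mathbb R^m$ be bounded and continuous, and a weak solution of $$IU=F(|x|,U)\ \text{ in }\Omega,\qquad U=0\ \text{ in }\mathbb R^N\setminus\Omega ,$$ that is, $u_i\in\mathcal D_k(\Omega)$ and $\mathcal E_k(u_i,\varphi)=\int_\Omega f_i(|x|,U(x))\,\varphi(x)\,dx$ for all $\varphi\in\mathcal D_k(\Omega)$ and $i=1,\dots,m$. For a unit vector $e$ let $\sigma_e(x)=x-2(x\cdot e)e$. Assume that there is $e_0\in S^{N-1}$ such that $u_i(x)\ge u_i(\sigma_{e_0}(x))$ for all $x\in\Omega$ with $x\cdot e_0>0$ and all $i$, and that $u_i(x)>u_i(\sigma_{e_0}(x))$ for at least one $i$ and one $x\in\Omega$ with $x\cdot e_0>0$. Assume moreover that one of the following holds: (a) $\partial f_j/\partial u_i>0$ on $(0,\infty)\times\mathbb R^m$ for all $i\neq j$ (this covers the case that these derivatives are positive on all of $[0,\infty)\times\mathbb R^m$); (b) $u_i>0$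 in $\Omega$ for all $i$, and $\partial f_j/\partial u_i>0$ on $(0,\infty)^{m+1}$ for all $i\neq j$. Then there is $p\in S^{N-1}$ such that every $u_i$, $i=1,\dots,m$, is - foliated Schwarz symmetric with respect to $p$ in $\Omega$: for every $r>0$ with $rS^{N-1}\subset\Omega$ and every $c\in\mathbb R$, the set $\{x\in rS^{N-1}: u_i(x)\ge c\}$ is either $rS^{N-1}$ or a (possibly empty) geodesic ball of the sphere $rS^{N-1}$ centered at $rp$; and - strictly decreasing in the polar angle: if $x,y\in\Omega\setminus\{0\}$, $|x|=|y|$ and $\arccos\left(\frac{x}{|x|}\cdot p\right)<\arccos\left(\frac{y}{|y|}\cdot p\right)$, then $u_i(y)<u_i(x)$. -/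

import Mathlib

open Set MeasureTheory
open scoped NNReal ENNReal

namespace NonlocalSystem

noncomputable section

/-- A kernel profile `k₀ : [0,∞) → [0,∞]` in dimension `N`: nonincreasing, with
`∫₀^∞ min{1,r²} k₀(r) r^(N-1) dr < ∞` and `∫₀^∞ k₀(r) r^(N-1) dr = ∞`. -/
structure IsKernelProfile (N : ℕ) (k₀ : ℝ≥0 → ℝ≥0∞) : Prop where
  antitone : Antitone k₀
  levy : ∫⁻ r in Ioi (0 : ℝ), ENNReal.ofReal (min 1 (r ^ 2) * r ^ (N - 1)) * k₀ r.toNNReal < ∞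
  singular : ∫⁻ r in Ioi (0 : ℝ), ENNReal.ofReal (r ^ (N - 1)) * k₀ r.toNNReal = ∞

/-- The radial kernel `k(z) = k₀(|z|)` on `ℝ^N`. -/
def kernel {N : ℕ} (k₀ : ℝ≥0 → ℝ≥0∞) (z : EuclideanSpace ℝ (Fin N)) : ℝ≥0∞ := k₀ ‖z‖₊

/-- The bilinear form
`E_k(u,v) = 1/2 ∫∫ (u(x) - u(y)) (v(x) - v(y)) k(x - y) dx dy`.
The kernel can take the value `∞` only at the origin, i.e. on the (null) diagonal. The integrand
is integrable whenever `u` and `v` belong to the energy space below. -/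
def bilin {N : ℕ} (k₀ : ℝ≥0 → ℝ≥0∞) (u v : EuclideanSpace ℝ (Fin N) → ℝ) : ℝ :=
  (1 / 2) * ∫ q : EuclideanSpace ℝ (Fin N) × EuclideanSpace ℝ (Fin N),
    (u q.1 - u q.2) * (v q.1 - v q.2) * (kernel k₀ (q.1 - q.2)).toReal

/-- Membership in `D_k(Ω) = {u ∈ L²(Ω) : E_k(u,u) < ∞}`; elements of `L²(Ω)` are functions
in `L²(ℝ^N)` that vanish outside `Ω`. -/
structure MemEnergySpace {N : ℕ} (k₀ : ℝ≥0 → ℝ≥0∞) (Ω : Set (EuclideanSpace ℝ (Fin N)))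
    (u : EuclideanSpace ℝ (Fin N) → ℝ) : Prop where
  memLp : MemLp u 2 volume
  zero_outside : ∀ x, x ∉ Ω → u x = 0
  energy_lt_top :
    ∫⁻ q : EuclideanSpace ℝ (Fin N) × EuclideanSpace ℝ (Fin N),
      ENNReal.ofReal ((u q.1 - u q.2) ^ 2) * kernel k₀ (q.1 - q.2) < ∞

/-- `U = (u₁,…,u_m)` is a weak solution of `I u_i = F_i(|x|, U)` in `Ω`, `u_i = 0` in `ℝ^N ∖ Ω`,
for `i = 1,…,m`: each `u_i` belongs to `D_k(Ω)` and
`E_k(u_i, φ) = ∫_Ω F_i(|x|, U(x)) φ(x) dx` for all `φ ∈ D_k(Ω)`. -/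
structure IsWeakSolution {N m : ℕ} (k₀ : ℝ≥0 → ℝ≥0∞) (Ω : Set (EuclideanSpace ℝ (Fin N)))
    (F : Fin m → ℝ → (Fin m → ℝ) → ℝ) (U : EuclideanSpace ℝ (Fin N) → Fin m → ℝ) : Prop where
  mem : ∀ i, MemEnergySpace k₀ Ω (fun x => U x i)
  eq : ∀ i, ∀ φ : EuclideanSpace ℝ (Fin N) → ℝ, MemEnergySpace k₀ Ω φ →
    bilin k₀ (fun x => U x i) φ = ∫ x in Ω, F i ‖x‖ (U x) * φ x

/-- A bounded radial domain of `ℝ^N`: open, connected (and nonempty), bounded and invariant under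
all rotations about the origin. -/
structure IsBoundedRadialDomain {N : ℕ} (Ω : Set (EuclideanSpace ℝ (Fin N))) : Prop where
  isOpen : IsOpen Ω
  isConnected : IsConnected Ω
  isBounded : Bornology.IsBounded Ω
  radial : ∀ x ∈ Ω, ∀ y, ‖y‖ = ‖x‖ → y ∈ Ω

/-- The partial derivative `∂F_j/∂u_i` at `(r, u)`. -/
def partialU {m : ℕ} (F : Fin m → ℝ → (Fin m → ℝ) → ℝ) (i j : Fin m) (r : ℝ) (u : Fin m → ℝ) : ℝ :=
  deriv (fun t => F j r (Function.update u i t)) (u i)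

/-- The reflection `σ_e(x) = x - 2 (x · e) e` at the hyperplane orthogonal to the unit vector `e`. -/
def reflect {N : ℕ} (e x : EuclideanSpace ℝ (Fin N)) : EuclideanSpace ℝ (Fin N) :=
  x - (2 * inner ℝ x e) • e

/-- `S` is a (open or closed) geodesic ball in the sphere `r S^(N-1)` centered at `r p`, where
`|p| = 1`. The geodesic distance of `x` and `r p` in this sphere is `r` times the angle between
`x` and `p`. The empty set counts as the open ball of radius `0`. -/
def IsGeodesicBall {N : ℕ} (p : EuclideanSpace ℝ (Fin N)) (r : ℝ)
    (S : Set (EuclideanSpace ℝ (Fin N))) : Prop :=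
  ∃ ρ : ℝ, 0 ≤ ρ ∧
    (S = {x | ‖x‖ = r ∧ r * InnerProductGeometry.angle x p < ρ} ∨
      S = {x | ‖x‖ = r ∧ r * InnerProductGeometry.angle x p ≤ ρ})

/-- `u` is foliated Schwarz symmetric with respect to `p` in the radial set `Ω`: on each sphere
`r S^(N-1) ⊆ Ω`, `r > 0`, every superlevel set `{u ≥ c}` is the whole sphere or a geodesic ball
centered at `r p`. -/
def IsFoliatedSchwarz {N : ℕ} (Ω : Set (EuclideanSpace ℝ (Fin N))) (p : EuclideanSpace ℝ (Fin N))
    (u : EuclideanSpace ℝ (Fin N) → ℝ) : Prop :=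
  ∀ r : ℝ, 0 < r → Metric.sphere 0 r ⊆ Ω → ∀ c : ℝ,
    {x | ‖x‖ = r ∧ c ≤ u x} = Metric.sphere 0 r ∨ IsGeodesicBall p r {x | ‖x‖ = r ∧ c ≤ u x}

/-- `u` is strictly decreasing in the polar angle `θ = arccos (x/|x| · p)` on each sphere about
the origin contained in `Ω`. -/
def StrictlyDecreasingInPolarAngle {N : ℕ} (Ω : Set (EuclideanSpace ℝ (Fin N)))
    (p : EuclideanSpace ℝ (Fin N)) (u : EuclideanSpace ℝ (Fin N) → ℝ) : Prop :=
  ∀ x ∈ Ω, ∀ y ∈ Ω, ‖x‖ = ‖y‖ →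
    InnerProductGeometry.angle x p < InnerProductGeometry.angle y p → u y < u x

end

end NonlocalSystem

namespace NonlocalSystem

noncomputable section

/-! The proof moves the direction `e` of a reflection. The differences `w_i = u_i - u_i ∘ σ_e` are
antisymmetric and, by cooperativity and the local Lipschitz bound on `F`, satisfy linear
differential inequalities whose constant `L` does not depend on `e`. If all `w_i ≥ 0` in the
half-space `{x · e > 0}`, each `w_i` is either zero or positive in the half of `Ω`
(`pos_of_dominates`), and full coupling excludes a mixture of the two
(`strictlyDominates_of_dominates`).

Strict domination is an open condition on `e` (`eventually_strictlyDominates`): it persists on a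
compact set, and the rest of `Ω` has measure small enough for `exists_small_measure`. Domination is
a closed condition. Only identically vanishing differences can stop the motion, and these are
detected by the first moment `M = ∫ u_i(x) x dx` of one fixed component: since `2 e · M = ∫ w_i(x)
(x · e) dx`, the condition `e · M > 0` forces `w_i ≠ 0`. Hence strict domination is open and closed
in the half-space `{e · M > 0}`, which is connected and contains `e₀`; so it holds there for every
direction (`strictlyDominates_of_exists`).

Now let `p = M / |M|`. If `|x| = |y|` and `x · p > y · p`, the direction `x - y` is admissible and
its reflection exchanges `x` and `y`; so `u_i(y) < u_i(x)`. This gives strict monotonicity in the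
polar angle, and its nonstrict version with continuity gives foliated Schwarz symmetry.

The kernel is only nonincreasing, possibly constant on intervals or compactly supported. The maximum
principles therefore use its nonintegrability at the origin: it gives a Poincaré inequality with
arbitrarily large constant on small sets (`exists_poincare`) and a local strong maximum principle
(`pos_of_forall_exists_pos`), which the connectedness of the half-domain makes global. -/

/-- Euclidean `N`-space. -/
abbrev Euc (N : ℕ) := EuclideanSpace ℝ (Fin N)

/-- The real-valued kernel `z ↦ k(z)`. -/
def realKernel {N : ℕ} (k₀ : ℝ≥0 → ℝ≥0∞) (z : Euc N) : ℝ := (kernel k₀ z).toReal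

/-! ### Finiteness, integrability and singularity of the kernel. -/

section Kernel

variable {N : ℕ} {k₀ : ℝ≥0 → ℝ≥0∞}

/-- An infinite value at `r` would by monotonicity be taken on all of `(0, r)`, where the weight in
`levy` is positive. -/
lemma IsKernelProfile.ne_top (hk : IsKernelProfile N k₀) {r : ℝ≥0} (hr : 0 < r) : k₀ r ≠ ∞ := by
  intro h
  have h1 : ∫⁻ _ in Ioo (0 : ℝ) r, (∞ : ℝ≥0∞) ≤
      ∫⁻ r in Ioi (0 : ℝ), ENNReal.ofReal (min 1 (r ^ 2) * r ^ (N - 1)) * k₀ r.toNNReal := by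
    refine le_trans ?_ (lintegral_mono_set fun s (hs : s ∈ Ioo (0 : ℝ) r) => hs.1)
    refine setLIntegral_mono' measurableSet_Ioo fun s hs => ?_
    have h2 : k₀ s.toNNReal = ∞ := by
      have : s.toNNReal ≤ r := Real.toNNReal_le_iff_le_coe.2 hs.2.le
      exact top_le_iff.1 (h ▸ hk.antitone this)
    rw [h2, ENNReal.mul_top]
    have hs0 := hs.1
    have : 0 < min 1 (s ^ 2) * s ^ (N - 1) := by positivity
    simpa using this
  have h2 : ∫⁻ _ in Ioo (0 : ℝ) r, (∞ : ℝ≥0∞) = ∞ := by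
    rw [setLIntegral_const, ENNReal.top_mul]
    simpa using hr.ne'
  rw [h2] at h1
  exact (lt_irrefl _ (h1.trans_lt hk.levy))

lemma IsKernelProfile.kernel_ne_top (hk : IsKernelProfile N k₀) {z : Euc N} (hz : z ≠ 0) :
    kernel k₀ z ≠ ∞ :=
  hk.ne_top (by simpa using hz)

lemma realKernel_nonneg (z : Euc N) : 0 ≤ realKernel k₀ z := ENNReal.toReal_nonneg

lemma realKernel_congr {z w : Euc N} (h : ‖z‖ = ‖w‖) : realKernel k₀ z = realKernel k₀ w := by
  have : ‖z‖₊ = ‖w‖₊ := by ext; simpa using h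
  simp [realKernel, kernel, this]

lemma realKernel_sub_comm (x y : Euc N) : realKernel k₀ (x - y) = realKernel k₀ (y - x) :=
  realKernel_congr (norm_sub_rev x y)

lemma IsKernelProfile.measurable_realKernel (hk : IsKernelProfile N k₀) :
    Measurable (realKernel k₀ : Euc N → ℝ) :=
  (hk.antitone.measurable.comp measurable_nnnorm).ennreal_toReal

lemma IsKernelProfile.realKernel_le (hk : IsKernelProfile N k₀) {z w : Euc N} (hz : z ≠ 0)
    (h : ‖z‖ ≤ ‖w‖) : realKernel k₀ w ≤ realKernel k₀ z :=
  ENNReal.toReal_mono (hk.kernel_ne_top hz) (hk.antitone h)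

/-- At the origin the kernel may be `∞`, which `toReal` sends to `0`; a vanishing factor makes the
two conventions agree. -/
lemma IsKernelProfile.ofReal_mul_kernel (hk : IsKernelProfile N k₀) {a : ℝ} (z : Euc N)
    (ha : 0 ≤ a) (h : z = 0 → a = 0) :
    ENNReal.ofReal a * kernel k₀ z = ENNReal.ofReal (a * realKernel k₀ z) := by
  by_cases hz : z = 0
  · simp [h hz]
  · rw [ENNReal.ofReal_mul ha, realKernel, ENNReal.ofReal_toReal (hk.kernel_ne_top hz)]

variable [Nontrivial (Euc N)]

lemma IsKernelProfile.integrable_min_mul (hk : IsKernelProfile N k₀) :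
    Integrable (fun z : Euc N => min 1 (‖z‖ ^ 2) * realKernel k₀ z) := by
  have key := integrable_fun_norm_addHaar (volume : Measure (Euc N))
    (f := fun r : ℝ => min 1 (r ^ 2) * (k₀ r.toNNReal).toReal)
  have e : (fun z : Euc N => min 1 (‖z‖ ^ 2) * realKernel k₀ z) =
      fun z => (fun r : ℝ => min 1 (r ^ 2) * (k₀ r.toNNReal).toReal) ‖z‖ := by
    ext z
    simp [realKernel, kernel, norm_toNNReal]
  rw [e, key]
  have hm : Measurable fun r : ℝ => k₀ r.toNNReal :=
    hk.antitone.measurable.comp measurable_real_toNNReal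
  have hm' : Measurable fun r : ℝ => r ^ (Module.finrank ℝ (Euc N) - 1) •
      (min 1 (r ^ 2) * (k₀ r.toNNReal).toReal) := by
    have := hm.ennreal_toReal
    fun_prop
  refine ⟨hm'.aestronglyMeasurable, ?_⟩
  refine lt_of_le_of_lt (lintegral_mono_ae ?_) hk.levy
  refine (ae_restrict_iff' measurableSet_Ioi).2 (Filter.Eventually.of_forall fun r hr => ?_)
  have hr' : (0 : ℝ) < r := hr
  have h0 : k₀ r.toNNReal ≠ ∞ := hk.ne_top (by simpa using hr')
  rw [Real.enorm_of_nonneg (by positivity), finrank_euclideanSpace, Fintype.card_fin]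
  simp only [smul_eq_mul]
  rw [← mul_assoc, mul_comm (r ^ (N - 1)), ENNReal.ofReal_mul (by positivity),
    ENNReal.ofReal_toReal h0]

lemma IsKernelProfile.not_integrable (hk : IsKernelProfile N k₀) :
    ¬ Integrable (realKernel k₀ : Euc N → ℝ) := by
  have key := integrable_fun_norm_addHaar (volume : Measure (Euc N))
    (f := fun r : ℝ => (k₀ r.toNNReal).toReal)
  have e : (realKernel k₀ : Euc N → ℝ) = fun z => (fun r : ℝ => (k₀ r.toNNReal).toReal) ‖z‖ := by
    ext z
    simp [realKernel, kernel, norm_toNNReal]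
  rw [e, key]
  rintro ⟨-, h⟩
  refine absurd hk.singular (ne_of_lt (lt_of_le_of_lt (lintegral_mono_ae ?_) h))
  refine (ae_restrict_iff' measurableSet_Ioi).2 (Filter.Eventually.of_forall fun r hr => ?_)
  have hr' : (0 : ℝ) < r := hr
  have h0 : k₀ r.toNNReal ≠ ∞ := hk.ne_top (by simpa using hr')
  rw [Real.enorm_of_nonneg (by positivity), finrank_euclideanSpace, Fintype.card_fin]
  simp only [smul_eq_mul]
  rw [ENNReal.ofReal_mul (by positivity), ENNReal.ofReal_toReal h0]

lemma IsKernelProfile.lintegral_eq_top (hk : IsKernelProfile N k₀) :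
    ∫⁻ z : Euc N, ENNReal.ofReal (realKernel k₀ z) = ∞ := by
  by_contra h
  refine hk.not_integrable ⟨hk.measurable_realKernel.aestronglyMeasurable, ?_⟩
  rw [hasFiniteIntegral_iff_ofReal (Filter.Eventually.of_forall realKernel_nonneg)]
  exact lt_top_iff_ne_top.2 h

/-- The kernel is unbounded near the origin. -/
lemma IsKernelProfile.exists_le_realKernel (hk : IsKernelProfile N k₀) (b : ℝ) :
    ∃ η > 0, ∀ z : Euc N, z ≠ 0 → ‖z‖ ≤ η → b ≤ realKernel k₀ z := by
  by_contra! hcon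
  have hb : ∀ w : Euc N, w ≠ 0 → realKernel k₀ w ≤ b := fun w hw => by
    obtain ⟨z, hz, hzw, hzb⟩ := hcon ‖w‖ (norm_pos_iff.2 hw)
    exact (hk.realKernel_le hz hzw).trans hzb.le
  refine hk.not_integrable ?_
  have h1 : Integrable ((Metric.ball (0 : Euc N) 1).indicator fun _ => |b| + realKernel k₀ (0 : Euc N)) :=
    (integrable_indicator_iff measurableSet_ball).2 (integrableOn_const measure_ball_lt_top.ne)
  -- A kernel bounded by `b` would be integrable: near the origin it is below a constant, and
  -- outside the unit ball the weight `min 1 |z|²` equals `1`. The summand `realKernel k₀ 0` covers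
  -- the value at the origin.
  refine (h1.add hk.integrable_min_mul).mono' hk.measurable_realKernel.aestronglyMeasurable
    (Filter.Eventually.of_forall fun z => ?_)
  rw [Real.norm_of_nonneg (realKernel_nonneg z), Pi.add_apply]
  have h0 := realKernel_nonneg (k₀ := k₀) (0 : Euc N)
  have hz := realKernel_nonneg (k₀ := k₀) z
  by_cases h : z ∈ Metric.ball (0 : Euc N) 1
  · rw [indicator_of_mem h]
    have h2 : 0 ≤ min 1 (‖z‖ ^ 2) * realKernel k₀ z := by positivity
    by_cases hz0 : z = 0
    · subst hz0; linarith [abs_nonneg b]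
    · linarith [hb z hz0, le_abs_self b]
  · rw [indicator_of_notMem h]
    have : 1 ≤ ‖z‖ := by simpa using h
    rw [min_eq_left (one_le_pow₀ this)]
    linarith

end Kernel

/-! ### The energy space and the bilinear form. -/

section Energy

variable {N : ℕ} {k₀ : ℝ≥0 → ℝ≥0∞} {Ω : Set (Euc N)} {u v : Euc N → ℝ}

lemma bilin_eq (u v : Euc N → ℝ) : bilin k₀ u v = (1 / 2) * ∫ q : Euc N × Euc N,
    (u q.1 - u q.2) * (v q.1 - v q.2) * realKernel k₀ (q.1 - q.2) := rfl

lemma IsKernelProfile.energy_integrand (hk : IsKernelProfile N k₀) (u : Euc N → ℝ)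
    (q : Euc N × Euc N) :
    ENNReal.ofReal ((u q.1 - u q.2) ^ 2) * kernel k₀ (q.1 - q.2) =
      ENNReal.ofReal ((u q.1 - u q.2) ^ 2 * realKernel k₀ (q.1 - q.2)) :=
  hk.ofReal_mul_kernel _ (sq_nonneg _) fun h => by simp [sub_eq_zero.1 h]

lemma energy_nonneg (u : Euc N → ℝ) (q : Euc N × Euc N) :
    0 ≤ (u q.1 - u q.2) ^ 2 * realKernel k₀ (q.1 - q.2) :=
  mul_nonneg (sq_nonneg _) (realKernel_nonneg _)

lemma IsKernelProfile.aestronglyMeasurable_mul (hk : IsKernelProfile N k₀)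
    (hu : AEStronglyMeasurable u) (hv : AEStronglyMeasurable v) :
    AEStronglyMeasurable (fun q : Euc N × Euc N =>
      (u q.1 - u q.2) * (v q.1 - v q.2) * realKernel k₀ (q.1 - q.2)) :=
  ((hu.comp_fst.sub hu.comp_snd).mul (hv.comp_fst.sub hv.comp_snd)).mul
    (hk.measurable_realKernel.comp (measurable_fst.sub measurable_snd)).aestronglyMeasurable

lemma IsKernelProfile.aestronglyMeasurable_sq (hk : IsKernelProfile N k₀)
    (hu : AEStronglyMeasurable u) :
    AEStronglyMeasurable (fun q : Euc N × Euc N =>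
      (u q.1 - u q.2) ^ 2 * realKernel k₀ (q.1 - q.2)) := by
  simpa only [sq] using hk.aestronglyMeasurable_mul hu hu

lemma MemEnergySpace.integrable_sq (hk : IsKernelProfile N k₀) (hu : MemEnergySpace k₀ Ω u) :
    Integrable fun q : Euc N × Euc N => (u q.1 - u q.2) ^ 2 * realKernel k₀ (q.1 - q.2) := by
  refine ⟨hk.aestronglyMeasurable_sq hu.memLp.1, ?_⟩
  rw [hasFiniteIntegral_iff_ofReal (Filter.Eventually.of_forall (energy_nonneg u))]
  simpa only [hk.energy_integrand] using hu.energy_lt_top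

lemma MemEnergySpace.of_integrable (hk : IsKernelProfile N k₀) (hu : MemLp u 2 volume)
    (h0 : ∀ x, x ∉ Ω → u x = 0)
    (h : Integrable fun q : Euc N × Euc N => (u q.1 - u q.2) ^ 2 * realKernel k₀ (q.1 - q.2)) :
    MemEnergySpace k₀ Ω u := by
  refine ⟨hu, h0, ?_⟩
  simp only [hk.energy_integrand]
  exact (hasFiniteIntegral_iff_ofReal (Filter.Eventually.of_forall (energy_nonneg u))).1 h.2

lemma MemEnergySpace.integrable_mul (hk : IsKernelProfile N k₀) (hu : MemEnergySpace k₀ Ω u)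
    (hv : MemEnergySpace k₀ Ω v) :
    Integrable fun q : Euc N × Euc N =>
      (u q.1 - u q.2) * (v q.1 - v q.2) * realKernel k₀ (q.1 - q.2) := by
  refine ((hu.integrable_sq hk).add (hv.integrable_sq hk)).mono'
    (hk.aestronglyMeasurable_mul hu.memLp.1 hv.memLp.1) (Filter.Eventually.of_forall fun q => ?_)
  have h := realKernel_nonneg (k₀ := k₀) (q.1 - q.2)
  rw [Real.norm_eq_abs, abs_mul, abs_of_nonneg h, Pi.add_apply, ← add_mul]
  refine mul_le_mul_of_nonneg_right ?_ h
  rw [abs_le]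
  constructor <;> nlinarith [sq_nonneg (u q.1 - u q.2 + (v q.1 - v q.2)),
    sq_nonneg (u q.1 - u q.2 - (v q.1 - v q.2))]

lemma MemEnergySpace.sub (hk : IsKernelProfile N k₀) (hu : MemEnergySpace k₀ Ω u)
    (hv : MemEnergySpace k₀ Ω v) : MemEnergySpace k₀ Ω fun x => u x - v x := by
  refine .of_integrable hk (hu.memLp.sub hv.memLp)
    (fun x hx => by simp [hu.zero_outside x hx, hv.zero_outside x hx]) ?_
  refine (((hu.integrable_sq hk).add (hv.integrable_sq hk)).sub
    ((hu.integrable_mul hk hv).const_mul 2)).congr (Filter.Eventually.of_forall fun q => ?_)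
  simp only [Pi.add_apply, Pi.sub_apply]
  ring

lemma MemEnergySpace.const_mul (hk : IsKernelProfile N k₀) (hu : MemEnergySpace k₀ Ω u) (c : ℝ) :
    MemEnergySpace k₀ Ω fun x => c * u x := by
  refine .of_integrable hk (hu.memLp.const_mul c) (fun x hx => by simp [hu.zero_outside x hx]) ?_
  refine ((hu.integrable_sq hk).const_mul (c ^ 2)).congr (Filter.Eventually.of_forall fun q => ?_)
  simp only
  ring

lemma bilin_sub_left (hk : IsKernelProfile N k₀) {u' : Euc N → ℝ} (hu : MemEnergySpace k₀ Ω u)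
    (hu' : MemEnergySpace k₀ Ω u') (hv : MemEnergySpace k₀ Ω v) :
    bilin k₀ (fun x => u x - u' x) v = bilin k₀ u v - bilin k₀ u' v := by
  simp only [bilin_eq]
  rw [← mul_sub, ← integral_sub (hu.integrable_mul hk hv) (hu'.integrable_mul hk hv)]
  exact congrArg _ (integral_congr_ae (.of_forall fun q => by ring))

lemma bilin_const_mul_left (c : ℝ) (u v : Euc N → ℝ) :
    bilin k₀ (fun x => c * u x) v = c * bilin k₀ u v := by
  simp only [bilin_eq]
  rw [mul_left_comm, ← integral_const_mul c]
  exact congrArg _ (integral_congr_ae (.of_forall fun q => by simp only; ring))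

lemma bilin_self_nonneg (u : Euc N → ℝ) : 0 ≤ bilin k₀ u u := by
  rw [bilin_eq]
  refine mul_nonneg (by norm_num) (integral_nonneg fun q => ?_)
  exact mul_nonneg (mul_self_nonneg _) (realKernel_nonneg _)

lemma MemEnergySpace.integrable (hΩ : Bornology.IsBounded Ω) (hu : MemEnergySpace k₀ Ω u) :
    Integrable u := by
  obtain ⟨r, hr⟩ := hΩ.subset_closedBall 0
  have : IsFiniteMeasure (volume.restrict (Metric.closedBall (0 : Euc N) r)) :=
    ⟨by simpa using measure_closedBall_lt_top⟩
  have h := (hu.memLp.restrict (Metric.closedBall (0 : Euc N) r)).integrable (by norm_num)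
  refine (integrableOn_iff_integrable_of_support_subset fun x hx => ?_).1 h
  by_contra hx'
  exact hx (hu.zero_outside x fun h => hx' (hr h))

lemma MemEnergySpace.integrable_pow_two (hu : MemEnergySpace k₀ Ω u) :
    Integrable fun x => u x ^ 2 := hu.memLp.integrable_sq

end Energy

/-! ### Reflections and the folding of double integrals. -/

section Reflection

variable {N : ℕ}

/-- The reflection at the hyperplane orthogonal to `e`, which need not be a unit vector. -/
def reflection (e : Euc N) : Euc N ≃ₗᵢ[ℝ] Euc N := (Submodule.span ℝ {e})ᗮ.reflection

lemma reflection_apply (e x : Euc N) :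
    reflection e x = x - (2 * inner ℝ x e / ‖e‖ ^ 2) • e := by
  rw [reflection, Submodule.reflection_orthogonal_apply, Submodule.reflection_singleton_apply,
    real_inner_comm, two_smul, ← add_smul]
  simp only [RCLike.ofReal_real_eq_id, id]
  rw [neg_sub, ← add_div, two_mul]

lemma reflect_eq_reflection {e : Euc N} (he : ‖e‖ = 1) (x : Euc N) :
    reflect e x = reflection e x := by
  simp [reflection_apply, reflect, he]

@[simp] lemma reflection_reflection (e x : Euc N) : reflection e (reflection e x) = x :=
  Submodule.reflection_reflection _ x

lemma inner_reflection (e x : Euc N) : inner ℝ (reflection e x) e = - inner ℝ x e := by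
  by_cases he : e = 0
  · simp [he]
  have : ‖e‖ ≠ 0 := by simpa using he
  rw [reflection_apply, inner_sub_left, real_inner_smul_left, real_inner_self_eq_norm_sq]
  field_simp
  ring

lemma reflection_eq_self {e x : Euc N} (h : inner ℝ x e = 0) : reflection e x = x := by
  simp [reflection_apply, h]

/-- The squares differ by `4 (x · e)(y · e) / |e|²`. Through monotonicity of the kernel this is what
makes reflected interactions the weaker ones. -/
lemma norm_sub_le_norm_sub_reflection {e x y : Euc N} (hx : 0 ≤ inner ℝ x e)
    (hy : 0 ≤ inner ℝ y e) : ‖x - y‖ ≤ ‖x - reflection e y‖ := by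
  refine (pow_le_pow_iff_left₀ (norm_nonneg _) (norm_nonneg _) two_ne_zero).1 ?_
  rw [norm_sub_sq_real, norm_sub_sq_real, LinearIsometryEquiv.norm_map, reflection_apply,
    inner_sub_right, real_inner_smul_right]
  have : 0 ≤ 2 * inner ℝ y e / ‖e‖ ^ 2 * inner ℝ x e := by positivity
  linarith

lemma inner_add_inner_le (e x y : Euc N) :
    inner ℝ x e + inner ℝ y e ≤ ‖x - reflection e y‖ * ‖e‖ := by
  have := real_inner_le_norm (x - reflection e y) e
  rw [inner_sub_left, inner_reflection] at this
  linarith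

lemma norm_reflection_sub_reflection (e x y : Euc N) :
    ‖reflection e x - reflection e y‖ = ‖x - y‖ := by
  rw [← map_sub, LinearIsometryEquiv.norm_map]

lemma norm_reflection_sub (e x y : Euc N) :
    ‖reflection e x - y‖ = ‖x - reflection e y‖ := by
  conv_lhs => rw [← reflection_reflection e y]
  exact norm_reflection_sub_reflection e x _

lemma measurePreserving_reflection (e : Euc N) : MeasurePreserving (reflection e) :=
  (reflection e).measurePreserving

/-- The product of two maps, each of which is the identity or the reflection. -/
def foldMap (e : Euc N) (a b : Bool) : Euc N × Euc N → Euc N × Euc N :=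
  Prod.map (if a then reflection e else id) (if b then reflection e else id)

lemma measurePreserving_foldMap (e : Euc N) (a b : Bool) : MeasurePreserving (foldMap e a b) := by
  have h : ∀ a : Bool, MeasurePreserving (if a then reflection e else id : Euc N → Euc N) := by
    intro a
    cases a
    · simpa using MeasurePreserving.id _
    · simpa using measurePreserving_reflection e
  exact (h a).prod (h b)

lemma measurableEmbedding_foldMap (e : Euc N) (a b : Bool) :
    MeasurableEmbedding (foldMap e a b) := by
  have h : ∀ a : Bool, MeasurableEmbedding (if a then reflection e else id : Euc N → Euc N) := by
    intro a
    cases a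
    · simpa using MeasurableEmbedding.id
    · simpa using (reflection e).toHomeomorph.measurableEmbedding
  exact (h a).prodMap (h b)

/-- The sum of `G` over the four points obtained by reflecting either variable. -/
def foldSum {α : Type*} [Add α] (e : Euc N) (G : Euc N × Euc N → α) (x y : Euc N) : α :=
  G (x, y) + G (x, reflection e y) + G (reflection e x, y) + G (reflection e x, reflection e y)

lemma foldSum_swap_left {α : Type*} [AddCommMonoid α] (e : Euc N) (G : Euc N × Euc N → α)
    (x y : Euc N) : foldSum e G (reflection e x) y = foldSum e G x y := by
  simp only [foldSum, reflection_reflection]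
  abel

lemma foldSum_swap_right {α : Type*} [AddCommMonoid α] (e : Euc N) (G : Euc N × Euc N → α)
    (x y : Euc N) : foldSum e G x (reflection e y) = foldSum e G x y := by
  simp only [foldSum, reflection_reflection]
  abel

/-- A folded sum does not change when either variable is reflected, so both variables may be assumed
to lie in the closed half-space. -/
lemma foldSum_induction {α : Type*} [AddCommMonoid α] {β : Type*} [AddCommMonoid β]
    {e : Euc N} {G : Euc N × Euc N → α} {G' : Euc N × Euc N → β} {P : α → β → Prop}
    (h : ∀ x y, 0 ≤ inner ℝ x e → 0 ≤ inner ℝ y e → P (foldSum e G x y) (foldSum e G' x y))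
    (x y : Euc N) : P (foldSum e G x y) (foldSum e G' x y) := by
  have key : ∀ x : Euc N, 0 ≤ inner ℝ x e ∨ 0 ≤ inner ℝ (reflection e x) e := fun x => by
    rw [inner_reflection]
    rcases le_total 0 (inner ℝ x e) with h | h
    · exact .inl h
    · exact .inr (by linarith)
  rcases key x with hx | hx <;> rcases key y with hy | hy
  · exact h x y hx hy
  · simpa only [foldSum_swap_right] using h x _ hx hy
  · simpa only [foldSum_swap_left] using h _ y hx hy
  · simpa only [foldSum_swap_left, foldSum_swap_right] using h _ _ hx hy

/-- Reflecting either variable preserves the measure, so the integral of the folded sum is four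
times that of `G`. Sign questions thus become pointwise inequalities on the half-space. -/
lemma integral_nonpos_of_foldSum {e : Euc N} {G : Euc N × Euc N → ℝ} (hG : Integrable G)
    (h : ∀ x y, 0 ≤ inner ℝ x e → 0 ≤ inner ℝ y e → foldSum e G x y ≤ 0) :
    ∫ q, G q ≤ 0 := by
  have hi : ∀ a b, Integrable fun q => G (foldMap e a b q) := fun a b =>
    (measurePreserving_foldMap e a b).integrable_comp_of_integrable hG
  have hc : ∀ a b, ∫ q, G (foldMap e a b q) = ∫ q, G q := fun a b =>
    (measurePreserving_foldMap e a b).integral_comp (measurableEmbedding_foldMap e a b) G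
  have hs : ∫ q, (G (foldMap e false false q) + G (foldMap e false true q) +
      G (foldMap e true false q) + G (foldMap e true true q)) = 4 * ∫ q, G q := by
    have h1 : Integrable fun q => G (foldMap e false false q) + G (foldMap e false true q) :=
      (hi _ _).add (hi _ _)
    have h2 : Integrable fun q => G (foldMap e false false q) + G (foldMap e false true q) +
      G (foldMap e true false q) := h1.add (hi _ _)
    rw [integral_add h2 (hi _ _), integral_add h1 (hi _ _), integral_add (hi _ _) (hi _ _)]
    simp only [hc]
    ring
  have h0 : ∫ q, (G (foldMap e false false q) + G (foldMap e false true q) +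
      G (foldMap e true false q) + G (foldMap e true true q)) ≤ 0 := by
    refine integral_nonpos fun q => ?_
    exact foldSum_induction (G' := fun _ => (0 : ℝ)) (P := fun a _ => a ≤ 0) h q.1 q.2
  linarith

lemma lintegral_le_of_foldSum {e : Euc N} {G G' : Euc N × Euc N → ℝ≥0∞} (hG : AEMeasurable G)
    (hG' : AEMeasurable G')
    (h : ∀ x y, 0 ≤ inner ℝ x e → 0 ≤ inner ℝ y e → foldSum e G x y ≤ foldSum e G' x y) :
    ∫⁻ q, G q ≤ ∫⁻ q, G' q := by
  have key : ∀ G : Euc N × Euc N → ℝ≥0∞, AEMeasurable G →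
      ∫⁻ q, (G (foldMap e false false q) + G (foldMap e false true q) +
      G (foldMap e true false q) + G (foldMap e true true q)) = 4 * ∫⁻ q, G q := by
    intro G hG
    have hi : ∀ a b, AEMeasurable fun q => G (foldMap e a b q) := fun a b =>
      hG.comp_quasiMeasurePreserving (measurePreserving_foldMap e a b).quasiMeasurePreserving
    have hc : ∀ a b, ∫⁻ q, G (foldMap e a b q) = ∫⁻ q, G q := fun a b =>
      (measurePreserving_foldMap e a b).lintegral_comp_emb (measurableEmbedding_foldMap e a b) G
    rw [lintegral_add_right' _ (hi _ _), lintegral_add_right' _ (hi _ _),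
      lintegral_add_right' _ (hi _ _)]
    simp only [hc]
    ring
  have h1 : 4 * ∫⁻ q, G q ≤ 4 * ∫⁻ q, G' q := by
    rw [← key G hG, ← key G' hG']
    exact lintegral_mono fun q => foldSum_induction (P := fun a b => a ≤ b) h q.1 q.2
  rwa [ENNReal.mul_le_mul_iff_right (by norm_num) (by norm_num)] at h1

end Reflection

/-! ### Testing the form against second differences. -/

section Shift

variable {N : ℕ}

lemma measurableEmbedding_shift :
    MeasurableEmbedding fun q : Euc N × Euc N => (q.2, q.2 + q.1) :=
  (MeasurableEquiv.prodComm.trans (MeasurableEquiv.shearAddRight (Euc N))).measurableEmbedding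

lemma measurePreserving_shift :
    MeasurePreserving fun q : Euc N × Euc N => (q.2, q.2 + q.1) :=
  measurePreserving_prod_add_swap volume volume

lemma integrable_shift {G : Euc N × Euc N → ℝ} (hG : Integrable G) :
    Integrable fun z => ∫ x, G (x, x + z) :=
  (measurePreserving_shift.integrable_comp_of_integrable hG).integral_prod_left

lemma integral_eq_integral_shift {G : Euc N × Euc N → ℝ} (hG : Integrable G) :
    ∫ q, G q = ∫ z, ∫ x, G (x, x + z) := by
  rw [← measurePreserving_shift.integral_comp measurableEmbedding_shift]
  exact integral_prod _ (measurePreserving_shift.integrable_comp_of_integrable hG)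

variable {k₀ : ℝ≥0 → ℝ≥0∞} {Ω : Set (Euc N)} {g v : Euc N → ℝ} [Nontrivial (Euc N)]

/-- If the second differences of `g` centered at the points of the support of `v ≥ 0` are bounded
below by `- C min{1,|z|²}`, then `E_k(g, v) ≤ C' ∫ v`. -/
lemma bilin_le_of_second_difference_le (hk : IsKernelProfile N k₀) (hg : MemEnergySpace k₀ Ω g)
    (hv : MemEnergySpace k₀ Ω v) (hvi : Integrable v) (hv0 : ∀ x, 0 ≤ v x) {B C : ℝ}
    (hB : ∀ x, |g x| ≤ B)
    (h : ∀ x, v x ≠ 0 → ∀ z, 2 * g x - g (x + z) - g (x - z) ≤ C * min 1 (‖z‖ ^ 2)) :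
    bilin k₀ g v ≤ (C / 2 * ∫ z : Euc N, min 1 (‖z‖ ^ 2) * realKernel k₀ z) * ∫ x, v x := by
  have hG := hg.integrable_mul hk hv
  rw [bilin_eq, integral_eq_integral_shift hG]
  have hker : ∀ x z : Euc N, realKernel k₀ (x - (x + z)) = realKernel k₀ z := fun x z =>
    realKernel_congr (by simp)
  have hle : ∀ z : Euc N, ∫ x, (g x - g (x + z)) * (v x - v (x + z)) * realKernel k₀ (x - (x + z)) ≤
      (C * ∫ x, v x) * (min 1 (‖z‖ ^ 2) * realKernel k₀ z) := by
    intro z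
    simp only [hker]
    rw [integral_mul_const, ← mul_assoc]
    refine mul_le_mul_of_nonneg_right ?_ (realKernel_nonneg z)
    have hgm : AEStronglyMeasurable g := hg.memLp.1
    have hgp : ∀ y, AEStronglyMeasurable fun x => g (x + y) := fun y =>
      hgm.comp_quasiMeasurePreserving
        (measurePreserving_add_right volume y).quasiMeasurePreserving
    have hvz : Integrable fun x => v (x + z) := hvi.comp_add_right z
    have hbd : ∀ y x, ‖g x - g (x + y)‖ ≤ 2 * B := fun y x => by
      rw [Real.norm_eq_abs]
      linarith [abs_sub (g x) (g (x + y)), hB x, hB (x + y)]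
    have i1 : Integrable fun x => (g x - g (x + z)) * v x :=
      hvi.bdd_mul (hgm.sub (hgp z)) (.of_forall (hbd z))
    have i2 : Integrable fun x => (g x - g (x + z)) * v (x + z) :=
      hvz.bdd_mul (hgm.sub (hgp z)) (.of_forall (hbd z))
    have i3 : Integrable fun x => (g (x - z) - g x) * v x := by
      have := i2.comp_sub_right z
      simpa using this
    -- Translating by `z` moves the increment from `v` to `g`: a product of first differences
    -- becomes a second difference of `g` times `v`.
    have e2 : ∫ x, (g x - g (x + z)) * v (x + z) = ∫ x, (g (x - z) - g x) * v x := by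
      rw [← integral_sub_right_eq_self _ z]
      simp
    calc ∫ x, (g x - g (x + z)) * (v x - v (x + z))
        = (∫ x, (g x - g (x + z)) * v x) - ∫ x, (g (x - z) - g x) * v x := by
          rw [← e2, ← integral_sub i1 i2]
          exact integral_congr_ae (.of_forall fun x => by simp only; ring)
      _ = ∫ x, (2 * g x - g (x + z) - g (x - z)) * v x := by
          rw [← integral_sub i1 i3]
          exact integral_congr_ae (.of_forall fun x => by simp only; ring)
      _ ≤ ∫ x, (C * min 1 (‖z‖ ^ 2)) * v x := by
          refine integral_mono (((i1.sub i3)).congr (.of_forall fun x => ?_))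
            (hvi.const_mul _) fun x => ?_
          · simp only [Pi.sub_apply]
            ring
          · by_cases hx : v x = 0
            · simp [hx]
            · exact mul_le_mul_of_nonneg_right (h x hx z) (hv0 x)
      _ = C * (∫ x, v x) * min 1 (‖z‖ ^ 2) := by
          rw [integral_const_mul]
          ring
  have := integral_mono (integrable_shift hG) (hk.integrable_min_mul.const_mul (C * ∫ x, v x)) hle
  rw [integral_const_mul] at this
  simp only at this ⊢
  linarith

end Shift

/-! ### Antisymmetric functions and their negative part on a half-space. -/

section Antisymmetric

variable {N : ℕ} {k₀ : ℝ≥0 → ℝ≥0∞} {Ω : Set (Euc N)} {e : Euc N} {z : Euc N → ℝ}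

lemma MemEnergySpace.comp_reflection (hk : IsKernelProfile N k₀) {u : Euc N → ℝ}
    (hΩ : ∀ x ∈ Ω, reflection e x ∈ Ω) (hu : MemEnergySpace k₀ Ω u) :
    MemEnergySpace k₀ Ω fun x => u (reflection e x) := by
  refine .of_integrable hk (hu.memLp.comp_measurePreserving (measurePreserving_reflection e))
    (fun x hx => hu.zero_outside _ fun h => hx (by simpa using hΩ _ h)) ?_
  refine ((measurePreserving_foldMap e true true).integrable_comp_of_integrable
    (hu.integrable_sq hk)).congr (.of_forall fun q => ?_)
  simp [foldMap, realKernel_congr (norm_reflection_sub_reflection e q.1 q.2)]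

lemma bilin_comp_reflection (u v : Euc N → ℝ) :
    bilin k₀ (fun x => u (reflection e x)) v = bilin k₀ u fun x => v (reflection e x) := by
  rw [bilin_eq, bilin_eq, ← (measurePreserving_foldMap e true true).integral_comp
    (measurableEmbedding_foldMap e true true)]
  simp [foldMap, realKernel_congr (norm_reflection_sub_reflection e _ _)]

/-- The negative part of `z`, cut off outside the half-space `{x · e > 0}`. -/
def halfNeg (e : Euc N) (z : Euc N → ℝ) (x : Euc N) : ℝ :=
  if 0 < inner ℝ x e then max (-z x) 0 else 0

lemma halfNeg_nonneg (x : Euc N) : 0 ≤ halfNeg e z x := by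
  unfold halfNeg
  split_ifs <;> simp

lemma abs_halfNeg_le (x : Euc N) : |halfNeg e z x| ≤ |z x| := by
  rw [abs_of_nonneg (halfNeg_nonneg x)]
  unfold halfNeg
  split_ifs
  · exact max_le (neg_le_abs _) (abs_nonneg _)
  · exact abs_nonneg _

lemma halfNeg_of_pos {x : Euc N} (hx : 0 < inner ℝ x e) : halfNeg e z x = max (-z x) 0 :=
  if_pos hx

/-- Antisymmetry forces `z = 0` on the hyperplane, so the formula extends to the closed half-space
on which folding works. -/
lemma halfNeg_of_nonneg (hz : ∀ x, z (reflection e x) = -z x) {x : Euc N}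
    (hx : 0 ≤ inner ℝ x e) : halfNeg e z x = max (-z x) 0 := by
  rcases hx.lt_or_eq with h | h
  · exact halfNeg_of_pos h
  · have h1 := hz x
    rw [reflection_eq_self h.symm] at h1
    have h2 : z x = 0 := by linarith
    simp [halfNeg, ← h, h2]

lemma halfNeg_reflection {x : Euc N} (hx : 0 ≤ inner ℝ x e) :
    halfNeg e z (reflection e x) = 0 := by
  rw [halfNeg, if_neg]
  rw [inner_reflection]
  linarith

lemma measurableSet_halfSpace (e : Euc N) : MeasurableSet {x : Euc N | 0 < inner ℝ x e} :=
  (isOpen_lt continuous_const (by fun_prop)).measurableSet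

lemma aestronglyMeasurable_halfNeg (hz : AEStronglyMeasurable z) :
    AEStronglyMeasurable (halfNeg e z) := by
  have : AEStronglyMeasurable fun x => max (-z x) 0 :=
    (continuous_id.max continuous_const).comp_aestronglyMeasurable hz.neg
  exact (this.indicator (measurableSet_halfSpace e)).congr
    (.of_forall fun x => by simp [halfNeg, indicator])

lemma memLp_halfNeg (hz : MemLp z 2 volume) : MemLp (halfNeg e z) 2 volume :=
  hz.mono (aestronglyMeasurable_halfNeg hz.1) (.of_forall fun x => abs_halfNeg_le x)

lemma IsKernelProfile.realKernel_reflection_le (hk : IsKernelProfile N k₀) {x y : Euc N}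
    (hx : 0 ≤ inner ℝ x e) (hy : 0 ≤ inner ℝ y e) (hxy : x ≠ y) :
    realKernel k₀ (x - reflection e y) ≤ realKernel k₀ (x - y) :=
  hk.realKernel_le (sub_ne_zero.2 hxy) (norm_sub_le_norm_sub_reflection hx hy)

lemma foldSum_ofReal {G : Euc N × Euc N → ℝ} (hG : ∀ q, 0 ≤ G q) (x y : Euc N) :
    foldSum e (fun q => ENNReal.ofReal (G q)) x y = ENNReal.ofReal (foldSum e G x y) := by
  have := hG (x, y)
  have := hG (x, reflection e y)
  have := hG (reflection e x, y)
  have := hG (reflection e x, reflection e y)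
  simp only [foldSum]
  rw [ENNReal.ofReal_add (by positivity) (by positivity),
    ENNReal.ofReal_add (by positivity) (by positivity),
    ENNReal.ofReal_add (by positivity) (by positivity)]

/-- The sharp cutoff costs no finiteness of energy because `z` already pays for crossing the
hyperplane. With `p, q` the negative parts and `b ≤ a` the two kernel values, `p² + q² ≤ ((z x - z
y)² + (z x + z y)²) / 2`, and both squares occur in the folded energy of `z`. -/
lemma foldSum_energy_halfNeg_le (hk : IsKernelProfile N k₀)
    (hz : ∀ x, z (reflection e x) = -z x) {x y : Euc N} (hx : 0 ≤ inner ℝ x e)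
    (hy : 0 ≤ inner ℝ y e) :
    foldSum e (fun q => (halfNeg e z q.1 - halfNeg e z q.2) ^ 2 * realKernel k₀ (q.1 - q.2)) x y ≤
      foldSum e (fun q => (z q.1 - z q.2) ^ 2 * realKernel k₀ (q.1 - q.2)) x y := by
  have ha := realKernel_nonneg (k₀ := k₀) (x - y)
  have hb := realKernel_nonneg (k₀ := k₀) (x - reflection e y)
  have hab := fun h => hk.realKernel_reflection_le hx hy (h : x ≠ y)
  simp only [foldSum, hz, halfNeg_reflection hx, halfNeg_reflection hy, halfNeg_of_nonneg hz hx,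
    halfNeg_of_nonneg hz hy, realKernel_congr (norm_reflection_sub_reflection e x y),
    realKernel_congr (norm_reflection_sub e x y)]
  set a := realKernel k₀ (x - y)
  set b := realKernel k₀ (x - reflection e y)
  have hp : ∀ t : ℝ, max (-t) 0 ^ 2 ≤ t ^ 2 := fun t => by
      rcases le_total t 0 with h | h
      · rw [max_eq_left (by linarith), neg_sq]
      · rw [max_eq_right (by linarith), zero_pow two_ne_zero]
        positivity
  have hpq : (max (-z x) 0 - max (-z y) 0) ^ 2 ≤ (z x - z y) ^ 2 := by
    rw [sq_le_sq]
    refine (abs_max_sub_max_le_abs _ _ _).trans_eq ?_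
    rw [← abs_neg]
    ring_nf
  have hpx := hp (z x)
  have hpy := hp (z y)
  set p := max (-z x) 0
  set q := max (-z y) 0
  have h1 := mul_le_mul_of_nonneg_right hpq ha
  have h2 := mul_le_mul_of_nonneg_right hpx hb
  have h3 := mul_le_mul_of_nonneg_right hpy hb
  have h4 : 0 ≤ (z x - z y) ^ 2 * a := by positivity
  have h5 : 0 ≤ (z x + z y) ^ 2 * b := by positivity
  -- On the diagonal `b ≤ a` may fail, since `a` is the `toReal` of a possibly infinite value; there
  -- the factor `z x - z y` vanishes.
  by_cases hxy : x = y
  · subst hxy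
    have : 0 ≤ z x ^ 2 * b := by positivity
    have e1 : z x ^ 2 = z x * z x := sq _
    nlinarith
  · have h6 := mul_le_mul_of_nonneg_left (hab hxy) (sq_nonneg (z x - z y))
    nlinarith

lemma MemEnergySpace.halfNeg (hk : IsKernelProfile N k₀) (hu : MemEnergySpace k₀ Ω z)
    (hz : ∀ x, z (reflection e x) = -z x) : MemEnergySpace k₀ Ω (halfNeg e z) := by
  refine ⟨memLp_halfNeg hu.memLp, fun x hx => ?_, lt_of_le_of_lt ?_ hu.energy_lt_top⟩
  · have := abs_halfNeg_le (e := e) (z := z) x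
    rw [hu.zero_outside x hx] at this
    simpa using this
  · simp only [hk.energy_integrand]
    refine lintegral_le_of_foldSum (e := e)
      (hk.aestronglyMeasurable_sq (memLp_halfNeg hu.memLp).1).aemeasurable.ennreal_ofReal
      (hk.aestronglyMeasurable_sq hu.memLp.1).aemeasurable.ennreal_ofReal fun x y hx hy => ?_
    rw [foldSum_ofReal (energy_nonneg _), foldSum_ofReal (energy_nonneg _)]
    exact ENNReal.ofReal_le_ofReal (foldSum_energy_halfNeg_le hk hz hx hy)

/-- Testing an antisymmetric function `z` with `v = z⁻ 1_{x·e>0}`. If `z ≥ ε` on a part `K` of the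
half-space, this is quantified by the amount by which the kernel exceeds its reflection. -/
lemma bilin_halfNeg_le (hk : IsKernelProfile N k₀) (hΩ : Bornology.IsBounded Ω)
    (hu : MemEnergySpace k₀ Ω z) (hz : ∀ x, z (reflection e x) = -z x) {K : Set (Euc N)}
    (hKm : MeasurableSet K) (hKf : volume K ≠ ∞) {ε : ℝ}
    (hK : ∀ x ∈ K, 0 < inner ℝ x e ∧ ε ≤ z x)
    (hc : ∀ x ∈ K, ∀ y, halfNeg e z y ≠ 0 →
      realKernel k₀ (x - reflection e y) + 1 ≤ realKernel k₀ (x - y)) :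
    bilin k₀ z (halfNeg e z) + bilin k₀ (halfNeg e z) (halfNeg e z) +
      ε * volume.real K * ∫ x, halfNeg e z x ≤ 0 := by
  have hv := hu.halfNeg hk hz
  have hvi := hv.integrable hΩ
  set v := NonlocalSystem.halfNeg e z with hvdef
  have hχ : Integrable (K.indicator fun _ => (1 : ℝ)) :=
    (integrable_indicator_iff hKm).2 (integrableOn_const hKf)
  set χ : Euc N → ℝ := K.indicator fun _ => (1 : ℝ) with hχdef
  have hχint : ∫ x, χ x = volume.real K := by
    rw [hχdef, integral_indicator hKm]
    simp
  have i1 := hu.integrable_mul hk hv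
  have i2 := hv.integrable_mul hk hv
  have i3 : Integrable fun q : Euc N × Euc N => χ q.1 * v q.2 := hχ.mul_prod hvi
  have i4 : Integrable fun q : Euc N × Euc N => v q.1 * χ q.2 := hvi.mul_prod hχ
  have h3 : ∫ q : Euc N × Euc N, χ q.1 * v q.2 = volume.real K * ∫ x, v x := by
    rw [← hχint]
    exact integral_prod_mul χ v
  have h4 : ∫ q : Euc N × Euc N, v q.1 * χ q.2 = (∫ x, v x) * volume.real K := by
    rw [← hχint]
    exact integral_prod_mul v χ
  have i12 := i1.add i2
  have i34 := (i3.add i4).const_mul ε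
  have hle := integral_nonpos_of_foldSum (e := e) (i12.add i34) fun x y hx hy => by
    have ha := realKernel_nonneg (k₀ := k₀) (x - y)
    have hb := realKernel_nonneg (k₀ := k₀) (x - reflection e y)
    have hab := fun h => hk.realKernel_reflection_le hx hy (h : x ≠ y)
    have hχ0 : ∀ x : Euc N, 0 ≤ inner ℝ x e → χ (reflection e x) = 0 := fun x hx => by
      refine indicator_of_notMem (fun h => ?_) _
      have := (hK _ h).1
      rw [inner_reflection] at this
      linarith
    have hχ1 : ∀ x, (x ∈ K ∧ χ x = 1) ∨ χ x = 0 := fun x => by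
      by_cases h : x ∈ K
      · exact .inl ⟨h, indicator_of_mem h _⟩
      · exact .inr (indicator_of_notMem h _)
    have hvx : v (reflection e x) = 0 := halfNeg_reflection hx
    have hvy : v (reflection e y) = 0 := halfNeg_reflection hy
    have hcx := fun h h' => hc x h y h'
    have hcy := fun h h' => hc y h x h'
    rw [realKernel_sub_comm y (reflection e x),
      realKernel_congr (norm_reflection_sub e x y), realKernel_sub_comm y x] at hcy
    simp only [foldSum, Pi.add_apply, hz, hχ0 x hx, hχ0 y hy, hvx, hvy,
      realKernel_congr (norm_reflection_sub_reflection e x y),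
      realKernel_congr (norm_reflection_sub e x y)]
    have hp : ∀ x : Euc N, 0 ≤ inner ℝ x e → 0 ≤ z x + v x ∧ (z x + v x) * v x = 0 := by
      intro x hx
      rw [hvdef, halfNeg_of_nonneg hz hx]
      rcases le_total (z x) 0 with h | h
      · rw [max_eq_left (by linarith)]
        simp
      · rw [max_eq_right (by linarith)]
        simpa using h
    obtain ⟨hP, hPp⟩ := hp x hx
    obtain ⟨hQ, hQq⟩ := hp y hy
    have hzvx : z x ≤ z x + v x := by linarith [halfNeg_nonneg (e := e) (z := z) x]
    have hzvy : z y ≤ z y + v y := by linarith [halfNeg_nonneg (e := e) (z := z) y]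
    have hp0 : 0 ≤ v x := halfNeg_nonneg x
    have hq0 : 0 ≤ v y := halfNeg_nonneg y
    have hKx := fun h => (hK x h).2
    have hKy := fun h => (hK y h).2
    -- The diagonal again lacks the kernel comparison; it is harmless because positive and negative
    -- parts at one point multiply to zero.
    have hdiag : x = y → (z x + v x) * v y = 0 ∧ (z y + v y) * v x = 0 := by
      rintro rfl
      exact ⟨hPp, hPp⟩
    set a := realKernel k₀ (x - y)
    set b := realKernel k₀ (x - reflection e y)
    set p := v x
    set q := v y
    -- Here `P, Q` are the positive parts, so `P p = Q q = 0`. The folded energy terms add up to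
    -- `-(P q + Q p)(a - b) - 2 p q b`, and the first product dominates the `ε` terms because `a - b
    -- ≥ 1` where they do not vanish.
    obtain ⟨P, hPdef⟩ : ∃ P, P = z x + p := ⟨_, rfl⟩
    obtain ⟨Q, hQdef⟩ : ∃ Q, Q = z y + q := ⟨_, rfl⟩
    rw [← hPdef] at hP hPp hzvx hdiag
    rw [← hQdef] at hQ hQq hzvy hdiag
    have zx : z x = P - p := by linarith
    have zy : z y = Q - q := by linarith
    have t1 : ε * (χ x * q) ≤ P * q * (a - b) := by
      by_cases hq : q = 0
      · simp [hq]
      rcases hχ1 x with ⟨hxK, h⟩ | h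
      · rw [h, one_mul]
        have h1 := hcx hxK hq
        have h2 := hKx hxK
        calc ε * q ≤ P * q := by gcongr; linarith
          _ = P * q * 1 := (mul_one _).symm
          _ ≤ P * q * (a - b) := by gcongr; linarith
      · rw [h]
        by_cases hxy : x = y
        · simp [(hdiag hxy).1]
        · have := hab hxy
          have : 0 ≤ a - b := by linarith
          simp only [zero_mul, mul_zero]
          positivity
    have t2 : ε * (p * χ y) ≤ Q * p * (a - b) := by
      by_cases hq : p = 0
      · simp [hq]
      rcases hχ1 y with ⟨hxK, h⟩ | h
      · rw [h, mul_one]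
        have h1 := hcy hxK hq
        have h2 := hKy hxK
        calc ε * p ≤ Q * p := by gcongr; linarith
          _ = Q * p * 1 := (mul_one _).symm
          _ ≤ Q * p * (a - b) := by gcongr; linarith
      · rw [h]
        by_cases hxy : x = y
        · simp [(hdiag hxy).2]
        · have := hab hxy
          have : 0 ≤ a - b := by linarith
          simp only [mul_zero]
          positivity
    have t3 : 0 ≤ p * q * b := by positivity
    rw [zx, zy]
    linear_combination t1 + t2 + 2 * t3 + (a + b) * hPp + (a + b) * hQq
  rw [integral_add' i12 i34, integral_add' i1 i2, integral_const_mul, integral_add' i3 i4, h3,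
    h4] at hle
  rw [bilin_eq, bilin_eq]
  linarith

end Antisymmetric

/-! ### A Poincaré inequality on small sets. -/

section Poincare

variable {N : ℕ} {k₀ : ℝ≥0 → ℝ≥0∞} {Ω : Set (Euc N)} [Nontrivial (Euc N)]

/-- Monotone convergence: the truncated integrals increase to the integral of the kernel, which is
infinite. -/
lemma IsKernelProfile.exists_le_lintegral_min (hk : IsKernelProfile N k₀) (b : ℝ≥0) :
    ∃ n : ℕ, (b : ℝ≥0∞) ≤ ∫⁻ z : Euc N, min (ENNReal.ofReal (realKernel k₀ z)) n := by
  have hm : Measurable fun z : Euc N => ENNReal.ofReal (realKernel k₀ z) :=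
    hk.measurable_realKernel.ennreal_ofReal
  have h1 : ∫⁻ z : Euc N, ⨆ n : ℕ, min (ENNReal.ofReal (realKernel k₀ z)) n =
      ⨆ n : ℕ, ∫⁻ z : Euc N, min (ENNReal.ofReal (realKernel k₀ z)) n :=
    lintegral_iSup (fun n => hm.min measurable_const) fun n n' h z => by
      simp only
      gcongr
  have h2 : ∀ z : Euc N, ⨆ n : ℕ, min (ENNReal.ofReal (realKernel k₀ z)) n =
      ENNReal.ofReal (realKernel k₀ z) := fun z => by
    refine le_antisymm (iSup_le fun n => min_le_left _ _) ?_
    obtain ⟨n, hn⟩ := exists_nat_ge (realKernel k₀ z)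
    refine le_iSup_of_le n (le_min le_rfl ?_)
    exact (ENNReal.ofReal_le_ofReal hn).trans (by simp)
  simp only [h2, hk.lintegral_eq_top] at h1
  have h3 : (b : ℝ≥0∞) < ⨆ n : ℕ, ∫⁻ z : Euc N, min (ENNReal.ofReal (realKernel k₀ z)) n := by
    rw [← h1]
    exact ENNReal.coe_lt_top
  obtain ⟨n, hn⟩ := lt_iSup_iff.1 h3
  exact ⟨n, hn.le⟩

/-- A Poincaré inequality on sets of small measure, with an arbitrarily large constant. -/
lemma IsKernelProfile.exists_poincare (hk : IsKernelProfile N k₀) (b : ℝ≥0) :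
    ∃ δ : ℝ≥0∞, δ ≠ 0 ∧ ∀ O : Set (Euc N), MeasurableSet O → volume O ≤ δ →
      ∀ u, MemEnergySpace k₀ Ω u → (∀ x, x ∉ O → u x = 0) →
        b * ∫ x, u x ^ 2 ≤ 2 * bilin k₀ u u := by
  -- The extra `1` pays for the truncated kernel on `O`, whose integral is at most `n |O| ≤ 1`. So
  -- at least `b` remains on `Oᶜ`, where `u` vanishes.
  obtain ⟨n, hn⟩ := hk.exists_le_lintegral_min (N := N) (b + 1)
  refine ⟨(n : ℝ≥0∞)⁻¹, by simp, fun O hO hOδ u hu huO => ?_⟩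
  have hm : Measurable fun z : Euc N => ENNReal.ofReal (realKernel k₀ z) :=
    hk.measurable_realKernel.ennreal_ofReal
  have h1 : ∀ x : Euc N, (b : ℝ≥0∞) ≤ ∫⁻ y in Oᶜ, ENNReal.ofReal (realKernel k₀ (x - y)) := by
    intro x
    have h2 : ((b : ℝ≥0∞) + 1) ≤
        ∫⁻ y, min (ENNReal.ofReal (realKernel k₀ (x - y))) (n : ℝ≥0∞) := by
      rw [lintegral_sub_left_eq_self
        (fun y : Euc N => min (ENNReal.ofReal (realKernel k₀ y)) (n : ℝ≥0∞)) x]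
      exact_mod_cast hn
    rw [← lintegral_add_compl _ hO] at h2
    have h3 : ∫⁻ y in O, min (ENNReal.ofReal (realKernel k₀ (x - y))) (n : ℝ≥0∞) ≤ 1 := by
      calc _ ≤ ∫⁻ _ in O, (n : ℝ≥0∞) := lintegral_mono fun y => min_le_right _ _
        _ = n * volume O := setLIntegral_const _ _
        _ ≤ n * (n : ℝ≥0∞)⁻¹ := by gcongr
        _ ≤ 1 := ENNReal.mul_inv_le_one _
    have h4 : ∫⁻ y in Oᶜ, min (ENNReal.ofReal (realKernel k₀ (x - y))) (n : ℝ≥0∞) ≤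
        ∫⁻ y in Oᶜ, ENNReal.ofReal (realKernel k₀ (x - y)) :=
      lintegral_mono fun y => min_le_left _ _
    have h5 := h2.trans (add_le_add h3 h4)
    rw [add_comm] at h5
    exact ENNReal.le_of_add_le_add_left (by simp) h5
  have h2 : ∫⁻ x, ENNReal.ofReal (u x ^ 2) * b ≤ ∫⁻ q : Euc N × Euc N,
      ENNReal.ofReal ((u q.1 - u q.2) ^ 2 * realKernel k₀ (q.1 - q.2)) := by
    rw [Measure.volume_eq_prod,
      lintegral_prod _ (hk.aestronglyMeasurable_sq hu.memLp.1).aemeasurable.ennreal_ofReal]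
    refine lintegral_mono fun x => ?_
    calc ENNReal.ofReal (u x ^ 2) * b
        ≤ ENNReal.ofReal (u x ^ 2) * ∫⁻ y in Oᶜ, ENNReal.ofReal (realKernel k₀ (x - y)) := by
          gcongr
          exact h1 x
      _ = ∫⁻ y in Oᶜ, ENNReal.ofReal (u x ^ 2) * ENNReal.ofReal (realKernel k₀ (x - y)) := by
          rw [lintegral_const_mul]
          exact hm.comp (measurable_const.sub measurable_id)
      _ ≤ ∫⁻ y in Oᶜ, ENNReal.ofReal ((u x - u y) ^ 2 * realKernel k₀ (x - y)) := by
          refine setLIntegral_mono' hO.compl fun y hy => ?_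
          rw [huO y hy, sub_zero, ENNReal.ofReal_mul (sq_nonneg _)]
      _ ≤ _ := setLIntegral_le_lintegral _ _
  have hb : (b : ℝ≥0∞) = ENNReal.ofReal b := (ENNReal.ofReal_coe_nnreal).symm
  simp only [hb, ← ENNReal.ofReal_mul (sq_nonneg _)] at h2
  rw [← ofReal_integral_eq_lintegral_ofReal (hu.integrable_pow_two.mul_const _)
      (.of_forall fun x => by positivity),
    ← ofReal_integral_eq_lintegral_ofReal (hu.integrable_sq hk) (.of_forall (energy_nonneg u)),
    ENNReal.ofReal_le_ofReal_iff (integral_nonneg (energy_nonneg u)), integral_mul_const] at h2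
  rw [bilin_eq]
  simp only [← sq]
  linarith

end Poincare

/-! ### A bump function of finite energy. -/

section Bump

variable {N : ℕ} {k₀ : ℝ≥0 → ℝ≥0∞} {Ω : Set (Euc N)} {c : Euc N} {ρ : ℝ}

/-- The semiconvex bump function `x ↦ (1 - |x - c|² / ρ²)⁺`. -/
def bump (c : Euc N) (ρ : ℝ) (x : Euc N) : ℝ := 1 - min 1 (‖x - c‖ / ρ) ^ 2

lemma bump_nonneg (hρ : 0 < ρ) (x : Euc N) : 0 ≤ bump c ρ x := by
  have h : 0 ≤ min 1 (‖x - c‖ / ρ) := by positivity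
  have h' := min_le_left 1 (‖x - c‖ / ρ)
  unfold bump
  nlinarith

lemma bump_le_one (x : Euc N) : bump c ρ x ≤ 1 := by
  unfold bump
  linarith [sq_nonneg (min 1 (‖x - c‖ / ρ))]

lemma bump_self : bump c ρ c = 1 := by simp [bump]

lemma bump_eq_zero (hρ : 0 < ρ) {x : Euc N} (hx : x ∉ Metric.ball c ρ) : bump c ρ x = 0 := by
  have : 1 ≤ ‖x - c‖ / ρ := by
    rw [le_div_iff₀ hρ]
    simpa [dist_eq_norm] using hx
  simp [bump, min_eq_left this]

lemma bump_pos (hρ : 0 < ρ) {x : Euc N} (hx : x ∈ Metric.ball c ρ) : 0 < bump c ρ x := by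
  have h1 : ‖x - c‖ / ρ < 1 := by
    rw [div_lt_one hρ]
    simpa [dist_eq_norm] using hx
  have h0 : 0 ≤ ‖x - c‖ / ρ := by positivity
  rw [bump, min_eq_right h1.le]
  nlinarith

lemma continuous_bump : Continuous (bump c ρ : Euc N → ℝ) := by
  unfold bump
  fun_prop

/-- Inside the ball the bound is the parallelogram law for the paraboloid below the bump. The kink
at the boundary is convex and has the favourable sign, so no smoothness is needed. -/
lemma bump_second_difference_le (hρ : 0 < ρ) (hρ1 : ρ ≤ 1) (x z : Euc N) :
    2 * bump c ρ x - bump c ρ (x + z) - bump c ρ (x - z) ≤ 2 / ρ ^ 2 * min 1 (‖z‖ ^ 2) := by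
  have h1 := bump_nonneg (c := c) hρ (x + z)
  have h2 := bump_nonneg (c := c) hρ (x - z)
  have hρ2 : ρ ^ 2 ≤ 1 := pow_le_one₀ hρ.le hρ1
  have h2ρ : 2 ≤ 2 / ρ ^ 2 := by
    rw [le_div_iff₀ (by positivity)]
    linarith
  rcases le_total 1 (‖z‖ ^ 2) with hz | hz
  · rw [min_eq_left hz]
    linarith [bump_le_one (c := c) (ρ := ρ) x]
  · rw [min_eq_right hz]
    by_cases hx : x ∈ Metric.ball c ρ
    · have hx1 : ‖x - c‖ / ρ ≤ 1 := by
        rw [div_le_one hρ]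
        simpa [dist_eq_norm] using (Metric.mem_ball.1 hx).le
      have key : ∀ y : Euc N, 1 - (‖y - c‖ / ρ) ^ 2 ≤ bump c ρ y := fun y => by
        have h0 : 0 ≤ ‖y - c‖ / ρ := by positivity
        have := pow_le_pow_left₀ (by positivity) (min_le_right 1 (‖y - c‖ / ρ)) 2
        unfold bump
        linarith
      have e0 : bump c ρ x = 1 - (‖x - c‖ / ρ) ^ 2 := by rw [bump, min_eq_right hx1]
      have p := parallelogram_law_with_norm ℝ (x - c) z
      have ep : x + z - c = x - c + z := by abel
      have em : x - z - c = x - c - z := by abel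
      have kp := key (x + z)
      have km := key (x - z)
      rw [ep] at kp
      rw [em] at km
      have e3 : (‖x - c + z‖ / ρ) ^ 2 + (‖x - c - z‖ / ρ) ^ 2 - 2 * (‖x - c‖ / ρ) ^ 2 =
          2 / ρ ^ 2 * ‖z‖ ^ 2 := by
        field_simp
        linarith
      linarith
    · rw [bump_eq_zero hρ hx]
      have : 0 ≤ 2 / ρ ^ 2 * ‖z‖ ^ 2 := by positivity
      linarith

lemma sq_bump_sub_bump_le (hρ : 0 < ρ) (hρ1 : ρ ≤ 1) (x y : Euc N) :
    (bump c ρ x - bump c ρ y) ^ 2 ≤ 4 / ρ ^ 2 * min 1 (‖x - y‖ ^ 2) := by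
  have hρ2 : ρ ^ 2 ≤ 1 := pow_le_one₀ hρ.le hρ1
  have h4ρ : 4 ≤ 4 / ρ ^ 2 := by
    rw [le_div_iff₀ (by positivity)]
    linarith
  have h1 := bump_nonneg (c := c) hρ x
  have h2 := bump_nonneg (c := c) hρ y
  have h3 := bump_le_one (c := c) (ρ := ρ) x
  have h4 := bump_le_one (c := c) (ρ := ρ) y
  rcases le_total 1 (‖x - y‖ ^ 2) with hz | hz
  · rw [min_eq_left hz]
    nlinarith
  · rw [min_eq_right hz]
    have hs : ∀ x : Euc N, 0 ≤ min 1 (‖x - c‖ / ρ) := fun x => by positivity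
    have hs1 : ∀ x : Euc N, min 1 (‖x - c‖ / ρ) ≤ 1 := fun x => min_le_left _ _
    have h5 : |min 1 (‖x - c‖ / ρ) - min 1 (‖y - c‖ / ρ)| ≤ ‖x - y‖ / ρ := by
      refine (abs_min_sub_min_le_max _ _ _ _).trans ?_
      rw [sub_self, abs_zero, max_eq_right (abs_nonneg _), ← sub_div, abs_div, abs_of_pos hρ]
      gcongr
      simpa using abs_norm_sub_norm_le (x - c) (y - c)
    have e : bump c ρ x - bump c ρ y = -((min 1 (‖x - c‖ / ρ) + min 1 (‖y - c‖ / ρ)) *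
        (min 1 (‖x - c‖ / ρ) - min 1 (‖y - c‖ / ρ))) := by
      unfold bump
      ring
    rw [e, neg_sq, mul_pow]
    calc _ ≤ (2 : ℝ) ^ 2 * (‖x - y‖ / ρ) ^ 2 :=
          mul_le_mul (pow_le_pow_left₀ (add_nonneg (hs x) (hs y)) (by linarith [hs1 x, hs1 y]) 2)
            (sq_le_sq.2 (h5.trans (le_abs_self _))) (sq_nonneg _) (by norm_num)
      _ = 4 / ρ ^ 2 * ‖x - y‖ ^ 2 := by ring

lemma memLp_bump (hρ : 0 < ρ) : MemLp (bump c ρ : Euc N → ℝ) 2 volume :=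
  continuous_bump.memLp_of_hasCompactSupport <|
    .of_support_subset_isCompact (isCompact_closedBall c ρ) fun x hx => by
      by_contra h
      exact hx (bump_eq_zero hρ fun h' => h (Metric.ball_subset_closedBall h'))

/-- An increment of the bump vanishes unless one of its points is in the ball, so the energy density
is dominated by the ball's indicator times the integrable weight `min 1 |z|² k(z)`, once for each
variable. -/
lemma memEnergySpace_bump [Nontrivial (Euc N)] (hk : IsKernelProfile N k₀) (hρ : 0 < ρ)
    (hρ1 : ρ ≤ 1) (hB : Metric.ball c ρ ⊆ Ω) : MemEnergySpace k₀ Ω (bump c ρ) := by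
  refine .of_integrable hk (memLp_bump hρ)
    (fun x hx => bump_eq_zero hρ fun h => hx (hB h)) ?_
  have hχ : Integrable ((Metric.ball c ρ).indicator fun _ => (1 : ℝ)) :=
    (integrable_indicator_iff measurableSet_ball).2 (integrableOn_const measure_ball_lt_top.ne)
  have i1 : Integrable fun q : Euc N × Euc N => (Metric.ball c ρ).indicator (fun _ => (1 : ℝ)) q.2 *
      (min 1 (‖q.1 - q.2‖ ^ 2) * realKernel k₀ (q.1 - q.2)) := by
    exact hχ.convolution_integrand (ContinuousLinearMap.mul ℝ ℝ) hk.integrable_min_mul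
  have i2 := i1.swap
  refine ((i1.add i2).const_mul (4 / ρ ^ 2)).mono'
    (hk.aestronglyMeasurable_sq (memLp_bump hρ).1) (.of_forall fun q => ?_)
  rw [Real.norm_of_nonneg (energy_nonneg _ q)]
  have h0 := realKernel_nonneg (k₀ := k₀) (q.1 - q.2)
  simp only [Pi.add_apply, Function.comp_apply, Prod.fst_swap, Prod.snd_swap,
    realKernel_sub_comm q.2 q.1, norm_sub_rev q.2 q.1]
  rw [← add_mul, ← mul_assoc, ← mul_assoc]
  refine mul_le_mul_of_nonneg_right ?_ h0
  by_cases hx : q.1 ∈ Metric.ball c ρ ∨ q.2 ∈ Metric.ball c ρ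
  · have h1 : 1 ≤ (Metric.ball c ρ).indicator (fun _ => (1 : ℝ)) q.2 +
        (Metric.ball c ρ).indicator (fun _ => (1 : ℝ)) q.1 := by
      have hn : ∀ x, 0 ≤ (Metric.ball c ρ).indicator (fun _ => (1 : ℝ)) x := fun x =>
        indicator_nonneg (fun _ _ => zero_le_one) x
      rcases hx with h | h
      · rw [indicator_of_mem h]
        linarith [hn q.2]
      · rw [indicator_of_mem h]
        linarith [hn q.1]
    calc _ ≤ 4 / ρ ^ 2 * 1 * min 1 (‖q.1 - q.2‖ ^ 2) := by
          rw [mul_one]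
          exact sq_bump_sub_bump_le hρ hρ1 _ _
      _ ≤ _ := by gcongr
  · rw [not_or] at hx
    rw [bump_eq_zero hρ hx.1, bump_eq_zero hρ hx.2]
    simp [hx.1, hx.2]

end Bump

/-! ### Monotonicity and Lipschitz bounds for cooperative nonlinearities. -/

section Nonlinearity

variable {m : ℕ} {F : Fin m → ℝ → (Fin m → ℝ) → ℝ}

lemma differentiable_update
    (hF : ∀ j, ContDiffOn ℝ 1 (fun q : ℝ × (Fin m → ℝ) => F j q.1 q.2) (Ici 0 ×ˢ univ))
    (i j : Fin m) {r : ℝ} (hr : 0 ≤ r) (u : Fin m → ℝ) :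
    Differentiable ℝ fun t => F j r (Function.update u i t) := by
  have h : ContDiff ℝ 1 fun t : ℝ => (r, Function.update u i t) :=
    contDiff_const.prodMk (contDiff_update 1 u i)
  have := (hF j).comp_contDiff h fun t => ⟨hr, mem_univ _⟩
  exact this.differentiable one_ne_zero

lemma deriv_update (i j : Fin m) (r : ℝ) (u : Fin m → ℝ) (t : ℝ) :
    deriv (fun t => F j r (Function.update u i t)) t =
      partialU F i j r (Function.update u i t) := by
  simp [partialU]

lemma monotone_update
    (hF : ∀ j, ContDiffOn ℝ 1 (fun q : ℝ × (Fin m → ℝ) => F j q.1 q.2) (Ici 0 ×ˢ univ))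
    (hcoop : ∀ i j, i ≠ j → ∀ r : ℝ, 0 ≤ r → ∀ u, 0 ≤ partialU F i j r u)
    {i j : Fin m} (hij : i ≠ j) {r : ℝ} (hr : 0 ≤ r) (u : Fin m → ℝ) :
    Monotone fun t => F j r (Function.update u i t) :=
  monotone_of_deriv_nonneg (differentiable_update hF i j hr u) fun t => by
    rw [deriv_update]
    exact hcoop i j hij r hr _

/-- A cooperative nonlinearity `F_j` is nondecreasing in the variables other than the `j`-th. -/
lemma le_of_le_of_eq
    (hF : ∀ j, ContDiffOn ℝ 1 (fun q : ℝ × (Fin m → ℝ) => F j q.1 q.2) (Ici 0 ×ˢ univ))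
    (hcoop : ∀ i j, i ≠ j → ∀ r : ℝ, 0 ≤ r → ∀ u, 0 ≤ partialU F i j r u)
    {j : Fin m} {r : ℝ} (hr : 0 ≤ r) {A B : Fin m → ℝ} (hBA : B ≤ A) (hj : B j = A j) :
    F j r B ≤ F j r A := by
  -- The coordinates are raised from `B` to `A` one at a time; the change of the `j`-th is void.
  have key : ∀ s : Finset (Fin m), F j r B ≤ F j r (s.piecewise A B) := by
    intro s
    induction s using Finset.induction_on with
    | empty => simp
    | insert i s hi ih =>
      rw [Finset.piecewise_insert]
      refine ih.trans ?_
      have hself : s.piecewise A B = Function.update (s.piecewise A B) i (B i) := by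
        rw [eq_comm, Function.update_eq_self_iff]
        simp [hi]
      by_cases hij : i = j
      · subst hij
        rw [← hj, ← hself]
      · conv_lhs => rw [hself]
        exact monotone_update hF hcoop hij hr _ (hBA i)
  simpa using key Finset.univ

/-- The `i`-th coordinate is raised first, so positivity of the derivative is needed only on a ray
from `B`. If all `B l` are positive, this ray stays in the positive cone, as the second coupling
alternative requires. -/
lemma lt_of_le_of_eq_of_lt
    (hF : ∀ j, ContDiffOn ℝ 1 (fun q : ℝ × (Fin m → ℝ) => F j q.1 q.2) (Ici 0 ×ˢ univ))
    (hcoop : ∀ i j, i ≠ j → ∀ r : ℝ, 0 ≤ r → ∀ u, 0 ≤ partialU F i j r u)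
    {i j : Fin m} {r : ℝ} (hr : 0 ≤ r) {A B : Fin m → ℝ} (hBA : B ≤ A) (hj : B j = A j)
    (hi : B i < A i)
    (hpos : ∀ t, B i ≤ t → 0 < partialU F i j r (Function.update B i t)) :
    F j r B < F j r A := by
  have hij : i ≠ j := by
    rintro rfl
    exact hi.ne hj
  have h1 : StrictMonoOn (fun t => F j r (Function.update B i t)) (Icc (B i) (A i)) := by
    refine strictMonoOn_of_deriv_pos (convex_Icc _ _)
      (differentiable_update hF i j hr B).continuous.continuousOn fun t ht => ?_
    rw [interior_Icc] at ht
    rw [deriv_update]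
    exact hpos t ht.1.le
  have h2 := h1 (left_mem_Icc.2 hi.le) (right_mem_Icc.2 hi.le) hi
  simp only [Function.update_eq_self] at h2
  refine h2.trans_le (le_of_le_of_eq hF hcoop hr ?_ ?_)
  · intro l
    by_cases h : l = i
    · subst h
      simp
    · simpa [h] using hBA l
  · simpa [hij.symm] using hj

lemma exists_lipschitz
    (hF : ∀ j, ContDiffOn ℝ 1 (fun q : ℝ × (Fin m → ℝ) => F j q.1 q.2) (Ici 0 ×ˢ univ))
    (R C : ℝ) : ∃ L : ℝ, 0 ≤ L ∧ ∀ j, ∀ r, 0 ≤ r → r ≤ R → ∀ A B : Fin m → ℝ,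
      ‖A‖ ≤ C → ‖B‖ ≤ C → |F j r A - F j r B| ≤ L * ‖A - B‖ := by
  have h1 : ∀ j, ∃ K : ℝ≥0, LipschitzOnWith K (fun q : ℝ × (Fin m → ℝ) => F j q.1 q.2)
      (Icc 0 R ×ˢ Metric.closedBall 0 C) := by
    intro j
    have hs : (Icc 0 R ×ˢ Metric.closedBall (0 : Fin m → ℝ) C) ⊆ Ici (0 : ℝ) ×ˢ univ :=
      prod_mono Icc_subset_Ici_self (subset_univ _)
    exact (((hF j).mono hs).locallyLipschitzOn
      ((convex_Icc _ _).prod (convex_closedBall _ _))).exists_lipschitzOnWith_of_compact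
      (isCompact_Icc.prod (isCompact_closedBall _ _))
  choose K hK using h1
  refine ⟨∑ j, (K j : ℝ), by positivity, fun j r hr hrR A B hA hB => ?_⟩
  have h2 := (hK j).dist_le_mul (r, A) ⟨⟨hr, hrR⟩, by simpa using hA⟩ (r, B)
    ⟨⟨hr, hrR⟩, by simpa using hB⟩
  rw [Real.dist_eq, Prod.dist_eq, dist_self, max_eq_right dist_nonneg, dist_eq_norm] at h2
  refine h2.trans (mul_le_mul_of_nonneg_right ?_ (norm_nonneg _))
  exact Finset.single_le_sum (f := fun j => (K j : ℝ)) (fun i _ => (K i).2) (Finset.mem_univ j)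

/-- A one-sided Lipschitz estimate for cooperative nonlinearities. -/
lemma exists_cooperative_lipschitz
    (hF : ∀ j, ContDiffOn ℝ 1 (fun q : ℝ × (Fin m → ℝ) => F j q.1 q.2) (Ici 0 ×ˢ univ))
    (hcoop : ∀ i j, i ≠ j → ∀ r : ℝ, 0 ≤ r → ∀ u, 0 ≤ partialU F i j r u)
    (R C : ℝ) : ∃ L : ℝ, 0 ≤ L ∧ ∀ j, ∀ r, 0 ≤ r → r ≤ R → ∀ A B : Fin m → ℝ,
      (∀ i, |A i| ≤ C) → (∀ i, |B i| ≤ C) →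
        -(L * (|A j - B j| + ∑ i, max (B i - A i) 0)) ≤ F j r A - F j r B := by
  obtain ⟨L, hL, h⟩ := exists_lipschitz hF R C
  refine ⟨L, hL, fun j r hr hrR A B hA hB => ?_⟩
  have hC : 0 ≤ C := (abs_nonneg _).trans (hA j)
  -- Off the `j`-th coordinate `A` is lowered to `min A B`, which does not increase `F j`. Then `A'`
  -- and `B` differ there only by the positive part of `B - A`.
  set A' : Fin m → ℝ := fun i => if i = j then A j else min (A i) (B i) with hA'
  have h1 : F j r A' ≤ F j r A := by
    refine le_of_le_of_eq hF hcoop hr (fun i => ?_) (by simp [hA'])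
    by_cases hij : i = j
    · simp [hA', hij]
    · simp [hA', hij]
  have hA'C : ‖A'‖ ≤ C := by
    rw [pi_norm_le_iff_of_nonneg hC]
    intro i
    by_cases hij : i = j
    · simpa [hA', hij] using hA j
    · simp only [hA', hij, if_false, Real.norm_eq_abs]
      rcases min_choice (A i) (B i) with h | h <;> rw [h]
      · exact hA i
      · exact hB i
  have hBC : ‖B‖ ≤ C := (pi_norm_le_iff_of_nonneg hC).2 hB
  have h2 := h j r hr hrR A' B hA'C hBC
  have hsum : 0 ≤ ∑ i, max (B i - A i) 0 := Finset.sum_nonneg fun i _ => le_max_right _ _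
  have h3 : ‖A' - B‖ ≤ |A j - B j| + ∑ i, max (B i - A i) 0 := by
    rw [pi_norm_le_iff_of_nonneg (by positivity)]
    intro i
    by_cases hij : i = j
    · subst hij
      simpa [hA'] using hsum
    · have h4 := Finset.single_le_sum (f := fun i => max (B i - A i) 0)
        (fun i _ => le_max_right _ _) (Finset.mem_univ i)
      have h5 : ‖(A' - B) i‖ ≤ max (B i - A i) 0 := by
        simp only [hA', hij, if_false, Real.norm_eq_abs, Pi.sub_apply]
        rcases le_total (A i) (B i) with h | h
        · rw [min_eq_left h, abs_of_nonpos (by linarith)]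
          exact (neg_sub _ _).le.trans (le_max_left _ _)
        · rw [min_eq_right h]
          simp
      have := abs_nonneg (A j - B j)
      linarith
  have h4 := mul_le_mul_of_nonneg_left h3 hL
  have h5 := neg_abs_le (F j r A' - F j r B)
  linarith

end Nonlinearity

/-! ### The local strong maximum principle. -/

section StrongMaximumPrinciple

variable {N : ℕ} {k₀ : ℝ≥0 → ℝ≥0∞} {Ω : Set (Euc N)} {e : Euc N} {w : Euc N → ℝ}

lemma isOpen_lt_inner (e : Euc N) (c : ℝ) : IsOpen {x : Euc N | c < inner ℝ x e} :=
  isOpen_lt continuous_const (by fun_prop)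

/-- The antisymmetric barrier `g = f - f ∘ σ_e` for a bump function `f` supported in the
half-space. -/
lemma barrier_second_difference_le {d ρ : ℝ} {x₀ : Euc N} (hd : 0 < d) (hρ : 0 < ρ) (hρ1 : ρ ≤ 1)
    (he : 0 < ‖e‖) (hB : ∀ x ∈ Metric.ball x₀ ρ, d * ‖e‖ < inner ℝ x e) {x : Euc N}
    (hx : x ∈ Metric.ball x₀ ρ) (z : Euc N) :
    2 * (bump x₀ ρ x - bump x₀ ρ (reflection e x)) -
        (bump x₀ ρ (x + z) - bump x₀ ρ (reflection e (x + z))) -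
        (bump x₀ ρ (x - z) - bump x₀ ρ (reflection e (x - z))) ≤
      (2 / ρ ^ 2 + 2 * (1 / min 1 (d ^ 2))) * min 1 (‖z‖ ^ 2) := by
  -- The reflected bump is felt only when `x + z` has crossed the hyperplane, which forces `|z| ≥
  -- d`.
  have hfar : ∀ z, bump x₀ ρ (reflection e (x + z)) ≤ 1 / min 1 (d ^ 2) * min 1 (‖z‖ ^ 2) := by
    intro z
    have hmin : 0 < min 1 (d ^ 2) := by positivity
    have hz0 : 0 ≤ min 1 (‖z‖ ^ 2) := by positivity
    by_cases h : reflection e (x + z) ∈ Metric.ball x₀ ρ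
    · have h1 := hB x hx
      have h0 := hB _ h
      rw [inner_reflection, inner_add_left] at h0
      have h2 := real_inner_le_norm (-z) e
      rw [inner_neg_left, norm_neg] at h2
      have h4 : 0 < d * ‖e‖ := by positivity
      have h3 : d ≤ ‖z‖ := le_of_mul_le_mul_right (by linarith) he
      refine (bump_le_one _).trans ?_
      rw [div_mul_eq_mul_div, one_mul, le_div_iff₀ hmin, one_mul]
      exact min_le_min_left _ (pow_le_pow_left₀ hd.le h3 2)
    · rw [bump_eq_zero hρ h]
      positivity
  have h1 := bump_second_difference_le (c := x₀) hρ hρ1 x z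
  have h2 := hfar z
  have h3 := hfar (-z)
  rw [norm_neg, ← sub_eq_add_neg] at h3
  have h4 := bump_nonneg (c := x₀) hρ (reflection e x)
  linarith

/-- Suppose `w x₀ = 0`. Subtract a small multiple `t g` of the antisymmetric barrier and test with
the negative part `v` of `w - t g` on the half-space, which is supported near `x₀`. A nearby ball
`K` with `w > ε` interacts with that support through the singular part of the kernel and gains `ε
|K| ∫ v`; the barrier and zero-order terms cost at most a constant times `t ∫ v`. For small `t` this
is contradictory, since `w x₀ = 0 < t` makes `∫ v > 0`. -/
lemma pos_of_forall_exists_pos [Nontrivial (Euc N)] (hk : IsKernelProfile N k₀)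
    (hΩb : Bornology.IsBounded Ω) (hΩo : IsOpen Ω) (hΩr : ∀ x ∈ Ω, reflection e x ∈ Ω)
    (he : e ≠ 0) (hw : MemEnergySpace k₀ Ω w) (hwc : Continuous w)
    (hanti : ∀ x, w (reflection e x) = -w x) (hw0 : ∀ x, 0 < inner ℝ x e → 0 ≤ w x)
    {L : ℝ} (hL : 0 ≤ L)
    (hsup : ∀ v, MemEnergySpace k₀ Ω v → (∀ x, 0 ≤ v x) → (∀ x, v x ≠ 0 → 0 < inner ℝ x e) →
      -(L * ∫ x, w x * v x) ≤ bilin k₀ w v)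
    {x₀ : Euc N} (hx₀ : x₀ ∈ Ω) (hx₀e : 0 < inner ℝ x₀ e)
    (hcl : ∀ η > 0, ∃ y, ‖y - x₀‖ < η ∧ 0 < inner ℝ y e ∧ 0 < w y) : 0 < w x₀ := by
  by_contra hneg
  have hwx₀ : w x₀ = 0 := le_antisymm (not_lt.1 hneg) (hw0 x₀ hx₀e)
  have hepos : 0 < ‖e‖ := norm_pos_iff.2 he
  -- `d` is half the distance from `x₀` to the hyperplane, so `b` below bounds the kernel between
  -- the support of `v` and the reflection of `K`.
  obtain ⟨d, hd, hde⟩ : ∃ d > 0, d * ‖e‖ = inner ℝ x₀ e / 2 :=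
    ⟨inner ℝ x₀ e / 2 / ‖e‖, by positivity, by field_simp⟩
  obtain ⟨b, hb⟩ : ∃ b, ∀ z : Euc N, d ≤ ‖z‖ → realKernel k₀ z ≤ b := by
    have hne : (d / ‖e‖) • e ≠ 0 := smul_ne_zero (by positivity) he
    refine ⟨realKernel k₀ ((d / ‖e‖) • e), fun z hz => hk.realKernel_le hne ?_⟩
    rw [norm_smul, Real.norm_of_nonneg (by positivity), div_mul_cancel₀ _ hepos.ne']
    exact hz
  obtain ⟨η, hη, hηk⟩ := hk.exists_le_realKernel (N := N) (b + 1)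
  -- Three distances below `η / 3` (the two radii and `|y₀ - x₀|`) keep `K` and the support of `v`
  -- within `η` of each other.
  obtain ⟨y₀, hy₀, hy₀e, hwy₀⟩ := hcl (η / 3) (by positivity)
  obtain ⟨ε, hε, hεw⟩ : ∃ ε > 0, ε < w y₀ := ⟨w y₀ / 2, by positivity, by linarith⟩
  obtain ⟨s, hs, hsη, hsK⟩ : ∃ s > 0, s ≤ η / 3 ∧
      ∀ x ∈ Metric.ball y₀ s, 0 < inner ℝ x e ∧ ε < w x := by
    have ho : IsOpen {x : Euc N | 0 < inner ℝ x e ∧ ε < w x} :=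
      (isOpen_lt_inner e 0).inter (isOpen_lt continuous_const hwc)
    obtain ⟨s, hs, h⟩ := Metric.isOpen_iff.1 ho y₀ ⟨hy₀e, hεw⟩
    exact ⟨min s (η / 3), by positivity, min_le_right _ _,
      fun x hx => h (Metric.ball_subset_ball (min_le_left _ _) hx)⟩
  -- The condition `w < ε` separates this ball from `K`; hence the bump vanishes on `K`, and the
  -- kernel is never evaluated at the origin in the comparison.
  obtain ⟨ρ, hρ, hρη, hρ1, hρB⟩ : ∃ ρ > 0, ρ ≤ η / 3 ∧ ρ ≤ 1 ∧
      ∀ x ∈ Metric.ball x₀ ρ, x ∈ Ω ∧ d * ‖e‖ < inner ℝ x e ∧ w x < ε := by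
    have ho : IsOpen {x : Euc N | x ∈ Ω ∧ d * ‖e‖ < inner ℝ x e ∧ w x < ε} :=
      hΩo.inter ((isOpen_lt_inner e _).inter (isOpen_lt hwc continuous_const))
    obtain ⟨s, hs, h⟩ := Metric.isOpen_iff.1 ho x₀
      ⟨hx₀, by rw [hde]; linarith, by rw [hwx₀]; exact hε⟩
    exact ⟨min s (min (η / 3) 1), by positivity,
      (min_le_right _ _).trans (min_le_left _ _), (min_le_right _ _).trans (min_le_right _ _),
      fun x hx => h (Metric.ball_subset_ball (min_le_left _ _) hx)⟩
  have hde0 : 0 < d * ‖e‖ := by positivity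
  set K := Metric.ball y₀ s with hKdef
  have hKf : volume K ≠ ∞ := measure_ball_lt_top.ne
  have hKpos : 0 < volume.real K := ENNReal.toReal_pos (Metric.measure_ball_pos _ _ hs).ne' hKf
  set f : Euc N → ℝ := bump x₀ ρ with hf
  have hfmem : MemEnergySpace k₀ Ω f :=
    memEnergySpace_bump hk hρ hρ1 fun x hx => (hρB x hx).1
  have hfσ : ∀ x, 0 ≤ inner ℝ x e → f (reflection e x) = 0 := fun x hx =>
    bump_eq_zero hρ fun h => by
      have := (hρB _ h).2.1
      rw [inner_reflection] at this
      linarith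
  set g : Euc N → ℝ := fun x => f x - f (reflection e x) with hg
  have hgmem : MemEnergySpace k₀ Ω g := hfmem.sub hk (hfmem.comp_reflection hk hΩr)
  have hgB : ∀ x, |g x| ≤ 1 := fun x => by
    rw [abs_le]
    constructor <;> linarith [bump_nonneg (c := x₀) hρ x, bump_le_one (c := x₀) (ρ := ρ) x,
      bump_nonneg (c := x₀) hρ (reflection e x), bump_le_one (c := x₀) (ρ := ρ) (reflection e x)]
  obtain ⟨M, hMpos, hsecond⟩ : ∃ M > 0, ∀ x ∈ Metric.ball x₀ ρ, ∀ z,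
      2 * g x - g (x + z) - g (x - z) ≤ M * min 1 (‖z‖ ^ 2) :=
    ⟨2 / ρ ^ 2 + 2 * (1 / min 1 (d ^ 2)), by positivity, fun x hx z =>
      barrier_second_difference_le hd hρ hρ1 hepos (fun y hy => (hρB y hy).2.1) hx z⟩
  obtain ⟨A, hA, hA0⟩ : ∃ A, ∫ z : Euc N, min 1 (‖z‖ ^ 2) * realKernel k₀ z = A ∧ 0 ≤ A :=
    ⟨_, rfl, integral_nonneg fun z => mul_nonneg (by positivity) (realKernel_nonneg z)⟩
  obtain ⟨κ, hκ, hκ0⟩ : ∃ κ, volume.real K = κ ∧ 0 < κ := ⟨_, rfl, hKpos⟩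
  obtain ⟨t, ht, htlt⟩ : ∃ t > 0, t * (L + M / 2 * A) < ε * κ := by
    have h1 : 0 < L + M / 2 * A + 1 := by positivity
    refine ⟨ε * κ / (L + M / 2 * A + 1), by positivity, ?_⟩
    rw [div_mul_eq_mul_div, div_lt_iff₀ h1]
    have : 0 < ε * κ := by positivity
    nlinarith
  set z : Euc N → ℝ := fun x => w x - t * g x with hz
  have hzmem : MemEnergySpace k₀ Ω z := hw.sub hk (hgmem.const_mul hk t)
  have hzanti : ∀ x, z (reflection e x) = -z x := fun x => by
    simp only [hz, hg, hanti, reflection_reflection]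
    ring
  have hzpos : ∀ x, 0 < inner ℝ x e → z x = w x - t * f x := fun x hx => by
    simp only [hz, hg, hfσ x hx.le, sub_zero]
  have hvmem := hzmem.halfNeg hk hzanti
  have hsupp : ∀ x, halfNeg e z x ≠ 0 → 0 < inner ℝ x e ∧ w x < t * f x := by
    intro x hx
    have hxe : 0 < inner ℝ x e := by
      by_contra h
      exact hx (if_neg h)
    refine ⟨hxe, ?_⟩
    by_contra h
    refine hx ?_
    rw [halfNeg_of_pos hxe, hzpos x hxe, max_eq_right]
    linarith
  have hball : ∀ x, halfNeg e z x ≠ 0 → x ∈ Metric.ball x₀ ρ := by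
    intro x hx
    obtain ⟨hxe, hlt⟩ := hsupp x hx
    by_contra h
    rw [hf, bump_eq_zero hρ h, mul_zero] at hlt
    linarith [hw0 x hxe]
  have key := bilin_halfNeg_le hk hΩb hzmem hzanti measurableSet_ball hKf (K := K) (ε := ε)
    (fun x hx => by
      refine ⟨(hsK x hx).1, ?_⟩
      have h1 : x ∉ Metric.ball x₀ ρ := fun h => by linarith [(hρB x h).2.2, (hsK x hx).2]
      rw [hzpos x (hsK x hx).1, hf, bump_eq_zero hρ h1]
      linarith [(hsK x hx).2])
    (fun x hx y hy => by
      have hyB := hball y hy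
      have h1 : realKernel k₀ (x - reflection e y) ≤ b := by
        refine hb _ (le_of_mul_le_mul_right ?_ hepos)
        linarith [inner_add_inner_le e x y, (hρB y hyB).2.1, (hsK x hx).1]
      have h2 : b + 1 ≤ realKernel k₀ (x - y) := by
        refine hηk _ (sub_ne_zero.2 fun h => ?_) ?_
        · subst h
          linarith [(hρB x hyB).2.2, (hsK x hx).2]
        · have e1 : x - y = (x - y₀) + (y₀ - x₀) - (y - x₀) := by abel
          rw [hKdef, mem_ball_iff_norm] at hx
          rw [mem_ball_iff_norm] at hyB
          rw [e1]
          linarith [norm_sub_le ((x - y₀) + (y₀ - x₀)) (y - x₀), norm_add_le (x - y₀) (y₀ - x₀)]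
      linarith)
  have hvi := hvmem.integrable hΩb
  have hv0 : ∀ x, 0 ≤ halfNeg e z x := halfNeg_nonneg
  have hI : 0 < ∫ x, halfNeg e z x := by
    rw [integral_pos_iff_support_of_nonneg hv0 hvi]
    have ho : IsOpen {x : Euc N | 0 < inner ℝ x e ∧ w x < t * f x} :=
      (isOpen_lt_inner e 0).inter
        (isOpen_lt hwc (continuous_const.mul continuous_bump))
    refine (ho.measure_pos volume ⟨x₀, hx₀e, ?_⟩).trans_le (measure_mono fun x hx => ?_)
    · rw [hwx₀, hf, bump_self, mul_one]
      exact ht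
    · rw [Function.mem_support, halfNeg_of_pos hx.1, hzpos x hx.1, max_eq_left]
      · linarith [hx.2]
      · linarith [hx.2]
  have h1 : bilin k₀ z (halfNeg e z) = bilin k₀ w (halfNeg e z) - t * bilin k₀ g (halfNeg e z) := by
    rw [hz, bilin_sub_left hk hw (hgmem.const_mul hk t) hvmem, bilin_const_mul_left]
  have h2 := hsup _ hvmem hv0 fun x hx => (hsupp x hx).1
  have h3 : ∫ x, w x * halfNeg e z x ≤ t * ∫ x, halfNeg e z x := by
    rw [← integral_const_mul]
    refine integral_mono_of_nonneg (.of_forall fun x => ?_) (hvi.const_mul t)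
      (.of_forall fun x => ?_)
    · by_cases hx : halfNeg e z x = 0
      · simp [hx]
      · exact mul_nonneg (hw0 x (hsupp x hx).1) (hv0 x)
    · by_cases hx : halfNeg e z x = 0
      · simp [hx]
      · refine mul_le_mul_of_nonneg_right ?_ (hv0 x)
        have := mul_le_mul_of_nonneg_left (bump_le_one (c := x₀) (ρ := ρ) x) ht.le
        linarith [(hsupp x hx).2]
  have h4 := bilin_le_of_second_difference_le hk hgmem hvmem hvi hv0 hgB
    fun x hx => hsecond x (hball x hx)
  rw [hA] at h4
  rw [hκ] at key
  have h5 := bilin_self_nonneg (k₀ := k₀) (halfNeg e z)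
  have h6 := mul_le_mul_of_nonneg_left h3 hL
  have h7 := mul_le_mul_of_nonneg_left h4 ht.le
  have h8 := mul_lt_mul_of_pos_right htlt hI
  linarith

end StrongMaximumPrinciple

/-! ### Equations for the differences and the small-measure maximum principle. -/

section System

variable {N m : ℕ} {k₀ : ℝ≥0 → ℝ≥0∞} {Ω : Set (Euc N)} {F : Fin m → ℝ → (Fin m → ℝ) → ℝ}
  {U : Euc N → Fin m → ℝ} {e : Euc N}

/-- A bounded continuous weak solution of a cooperative system in a bounded radial domain. -/
structure IsCooperativeSolution (k₀ : ℝ≥0 → ℝ≥0∞) (Ω : Set (Euc N))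
    (F : Fin m → ℝ → (Fin m → ℝ) → ℝ) (U : Euc N → Fin m → ℝ) : Prop where
  kernelProfile : IsKernelProfile N k₀
  domain : IsBoundedRadialDomain Ω
  contDiffOn : ∀ j, ContDiffOn ℝ 1 (fun q : ℝ × (Fin m → ℝ) => F j q.1 q.2) (Ici 0 ×ˢ univ)
  cooperative : ∀ i j, i ≠ j → ∀ r : ℝ, 0 ≤ r → ∀ u, 0 ≤ partialU F i j r u
  continuous : Continuous U
  bounded : ∃ C : ℝ, ∀ x i, |U x i| ≤ C
  solution : IsWeakSolution k₀ Ω F U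

/-- The difference of `U` and its reflection. -/
def diff (e : Euc N) (U : Euc N → Fin m → ℝ) (i : Fin m) (x : Euc N) : ℝ :=
  U x i - U (reflection e x) i

/-- The difference of the right-hand sides at a point and at its reflection. -/
def rhsDiff (F : Fin m → ℝ → (Fin m → ℝ) → ℝ) (e : Euc N) (U : Euc N → Fin m → ℝ) (i : Fin m)
    (x : Euc N) : ℝ :=
  F i ‖x‖ (U x) - F i ‖x‖ (U (reflection e x))

lemma diff_reflection (i : Fin m) (x : Euc N) : diff e U i (reflection e x) = -diff e U i x := by
  simp [diff]

lemma IsBoundedRadialDomain.reflection_mem (hΩ : IsBoundedRadialDomain Ω) {x : Euc N}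
    (hx : x ∈ Ω) : reflection e x ∈ Ω :=
  hΩ.radial x hx _ (LinearIsometryEquiv.norm_map _ _)

lemma IsBoundedRadialDomain.reflection_mem_iff (hΩ : IsBoundedRadialDomain Ω) {x : Euc N} :
    reflection e x ∈ Ω ↔ x ∈ Ω :=
  ⟨fun h => by simpa using hΩ.reflection_mem (e := e) h, hΩ.reflection_mem⟩

lemma IsBoundedRadialDomain.preimage_reflection (hΩ : IsBoundedRadialDomain Ω) :
    reflection e ⁻¹' Ω = Ω := by
  ext x
  exact hΩ.reflection_mem_iff

namespace IsCooperativeSolution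

lemma memEnergySpace_diff (h : IsCooperativeSolution k₀ Ω F U) (e : Euc N) (i : Fin m) :
    MemEnergySpace k₀ Ω (diff e U i) :=
  (h.solution.mem i).sub h.kernelProfile
    ((h.solution.mem i).comp_reflection h.kernelProfile fun _ hx => h.domain.reflection_mem hx)

lemma diff_eq_zero (h : IsCooperativeSolution k₀ Ω F U) {i : Fin m} {x : Euc N} (hx : x ∉ Ω) :
    diff e U i x = 0 :=
  (h.memEnergySpace_diff e i).zero_outside x hx

lemma continuous_apply (h : IsCooperativeSolution k₀ Ω F U) (i : Fin m) :
    Continuous fun x => U x i := (_root_.continuous_apply i).comp h.continuous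

lemma continuous_diff (h : IsCooperativeSolution k₀ Ω F U) (i : Fin m) :
    Continuous (diff e U i) :=
  (h.continuous_apply i).sub ((h.continuous_apply i).comp (reflection e).continuous)

lemma continuous_rhs (h : IsCooperativeSolution k₀ Ω F U) (i : Fin m) :
    Continuous fun x => F i ‖x‖ (U x) :=
  (h.contDiffOn i).continuousOn.comp_continuous (continuous_norm.prodMk h.continuous)
    fun x => ⟨norm_nonneg x, mem_univ _⟩

lemma rhsDiff_eq (i : Fin m) (x : Euc N) :
    rhsDiff F e U i x = F i ‖x‖ (U x) - F i ‖reflection e x‖ (U (reflection e x)) := by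
  rw [rhsDiff, LinearIsometryEquiv.norm_map]

lemma continuous_rhsDiff (h : IsCooperativeSolution k₀ Ω F U) (i : Fin m) :
    Continuous (rhsDiff F e U i) := by
  have hg := h.continuous_rhs i
  have : rhsDiff F e U i = _ := funext (rhsDiff_eq i)
  rw [this]
  exact hg.sub (hg.comp (reflection e).continuous)

lemma integrableOn_mul (h : IsCooperativeSolution k₀ Ω F U) {g v : Euc N → ℝ} (hg : Continuous g)
    (hv : MemEnergySpace k₀ Ω v) : IntegrableOn (fun x => g x * v x) Ω := by
  obtain ⟨R, hR⟩ := h.domain.isBounded.subset_closedBall 0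
  obtain ⟨C, hC⟩ := (isCompact_closedBall (0 : Euc N) R).exists_bound_of_continuousOn
    hg.continuousOn
  refine (hv.integrable h.domain.isBounded).integrableOn.bdd_mul (c := C)
    hg.aestronglyMeasurable.restrict ?_
  exact (ae_restrict_iff' h.domain.isOpen.measurableSet).2 (.of_forall fun x hx => hC x (hR hx))

/-- The weak equation of the difference of `U` and its reflection. -/
lemma bilin_diff (h : IsCooperativeSolution k₀ Ω F U) (e : Euc N) (i : Fin m) {v : Euc N → ℝ}
    (hv : MemEnergySpace k₀ Ω v) :
    bilin k₀ (diff e U i) v = ∫ x in Ω, rhsDiff F e U i x * v x := by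
  have hk := h.kernelProfile
  have hrefl : ∀ x ∈ Ω, reflection e x ∈ Ω := fun _ hx => h.domain.reflection_mem hx
  have hu := h.solution.mem i
  have hg := h.continuous_rhs i
  have e1 : bilin k₀ (fun x => U (reflection e x) i) v =
      ∫ x in Ω, F i ‖reflection e x‖ (U (reflection e x)) * v x := by
    rw [bilin_comp_reflection (fun x => U x i) v, h.solution.eq i _ (hv.comp_reflection hk hrefl),
      ← (measurePreserving_reflection e).setIntegral_preimage_emb
        (reflection e).toHomeomorph.measurableEmbedding, h.domain.preimage_reflection]
    simp only [reflection_reflection]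
  have i2 : IntegrableOn (fun x => F i ‖reflection e x‖ (U (reflection e x)) * v x) Ω :=
    h.integrableOn_mul (hg.comp (reflection e).continuous) hv
  unfold diff
  rw [bilin_sub_left hk hu (hu.comp_reflection hk hrefl) hv, h.solution.eq i v hv, e1,
    ← integral_sub (h.integrableOn_mul hg hv) i2]
  simp only [rhsDiff_eq, sub_mul]

lemma exists_le_rhsDiff (h : IsCooperativeSolution k₀ Ω F U) :
    ∃ L : ℝ, 0 ≤ L ∧ ∀ (e : Euc N) (i : Fin m), ∀ x ∈ Ω,
      -(L * (|diff e U i x| + ∑ j, max (-diff e U j x) 0)) ≤ rhsDiff F e U i x := by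
  obtain ⟨R, hR⟩ := h.domain.isBounded.subset_closedBall 0
  obtain ⟨C, hC⟩ := h.bounded
  obtain ⟨L, hL, hLF⟩ := exists_cooperative_lipschitz h.contDiffOn h.cooperative R C
  refine ⟨L, hL, fun e i x hx => ?_⟩
  have := hLF i ‖x‖ (norm_nonneg x) (by simpa using hR hx) (U x) (U (reflection e x))
    (hC x) (hC _)
  simpa only [diff, rhsDiff, neg_sub] using this

lemma integrable_diff_mul (h : IsCooperativeSolution k₀ Ω F U) (e : Euc N) (i : Fin m)
    {v : Euc N → ℝ} (hv : MemEnergySpace k₀ Ω v) :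
    IntegrableOn (fun x => (|diff e U i x| + ∑ j, max (-diff e U j x) 0) * v x) Ω := by
  refine h.integrableOn_mul ?_ hv
  have := fun j => h.continuous_diff (e := e) j
  fun_prop

/-- The point is that `L` is the same for all `e`, so that the measure threshold in
`exists_small_measure` is too. -/
lemma exists_le_bilin_diff (h : IsCooperativeSolution k₀ Ω F U) :
    ∃ L : ℝ, 0 ≤ L ∧ ∀ (e : Euc N) (i : Fin m) (v : Euc N → ℝ), MemEnergySpace k₀ Ω v →
      (∀ x, 0 ≤ v x) →
      -(L * ∫ x, (|diff e U i x| + ∑ j, max (-diff e U j x) 0) * v x) ≤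
        bilin k₀ (diff e U i) v := by
  obtain ⟨L, hL, hLF⟩ := h.exists_le_rhsDiff
  refine ⟨L, hL, fun e i v hv hv0 => ?_⟩
  rw [h.bilin_diff e i hv, ← setIntegral_eq_integral_of_forall_compl_eq_zero (s := Ω)
    fun x hx => by rw [hv.zero_outside x hx, mul_zero], ← integral_const_mul, ← integral_neg]
  refine setIntegral_mono_on ((h.integrable_diff_mul e i hv).const_mul L).neg
    (h.integrableOn_mul (h.continuous_rhsDiff i) hv) h.domain.isOpen.measurableSet fun x hx => ?_
  have := mul_le_mul_of_nonneg_right (hLF e i x hx) (hv0 x)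
  linarith

/-- The maximum principle for antisymmetric functions on sets of small measure. -/
lemma exists_small_measure [Nontrivial (Euc N)] (h : IsCooperativeSolution k₀ Ω F U) :
    ∃ δ : ℝ≥0∞, δ ≠ 0 ∧ ∀ (e : Euc N) (O : Set (Euc N)), MeasurableSet O → volume O ≤ δ →
      (∀ x, x ∉ O → 0 < inner ℝ x e → ∀ i, 0 ≤ diff e U i x) →
        ∀ x, 0 < inner ℝ x e → ∀ i, 0 ≤ diff e U i x := by
  obtain ⟨L, hL, hLB⟩ := h.exists_le_bilin_diff
  have hk := h.kernelProfile
  -- Let `S` be the sum of the `∫ v_i²`. The estimates summed over `i` bound the Poincaré side by `2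
  -- L (1 + m) S`; the extra `1` then forces `S ≤ 0`.
  obtain ⟨b, hb⟩ : ∃ b : ℝ≥0, (b : ℝ) = 2 * L * (1 + m) + 1 := ⟨⟨_, by positivity⟩, rfl⟩
  obtain ⟨δ, hδ, hP⟩ := hk.exists_poincare (Ω := Ω) b
  refine ⟨δ, hδ, fun e O hO hOδ hpos => ?_⟩
  set v : Fin m → Euc N → ℝ := fun i => halfNeg e (diff e U i) with hv
  have hvmem : ∀ i, MemEnergySpace k₀ Ω (v i) := fun i =>
    (h.memEnergySpace_diff e i).halfNeg hk (diff_reflection i)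
  have hv0 : ∀ i x, 0 ≤ v i x := fun i => halfNeg_nonneg
  have hvO : ∀ i x, x ∉ O → v i x = 0 := fun i x hx => by
    simp only [hv, halfNeg]
    split_ifs with hxe
    · rw [max_eq_right]
      linarith [hpos x hx hxe i]
    · rfl
  have hsq : ∀ i, Integrable fun x => v i x ^ 2 := fun i => (hvmem i).integrable_pow_two
  have h1 : ∀ i, bilin k₀ (v i) (v i) ≤
      L * ∫ x, (|diff e U i x| + ∑ j, max (-diff e U j x) 0) * v i x := fun i => by
    have ha := hLB e i (v i) (hvmem i) (hv0 i)
    -- No quantitative gain is needed here, hence the empty `K`.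
    have hb := bilin_halfNeg_le hk h.domain.isBounded (h.memEnergySpace_diff e i)
      (diff_reflection i) (K := ∅) (ε := 0) MeasurableSet.empty (by simp) (by simp) (by simp)
    rw [zero_mul, zero_mul, add_zero] at hb
    simp only [hv] at ha ⊢
    linarith
  have h2 : ∀ i, ∫ x, (|diff e U i x| + ∑ j, max (-diff e U j x) 0) * v i x ≤
      (1 + m / 2) * (∫ x, v i x ^ 2) + 1 / 2 * ∑ j, ∫ x, v j x ^ 2 := fun i => by
    rw [← integral_finsetSum _ fun j _ => hsq j, ← integral_const_mul, ← integral_const_mul,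
      ← integral_add ((hsq i).const_mul _) ((integrable_finsetSum _ fun j _ => hsq j).const_mul _)]
    refine integral_mono_of_nonneg (.of_forall fun x => ?_) (((hsq i).const_mul _).add
      ((integrable_finsetSum _ fun j _ => hsq j).const_mul _)) (.of_forall fun x => ?_)
    · exact mul_nonneg (add_nonneg (abs_nonneg _) (Finset.sum_nonneg fun j _ => le_max_right _ _))
        (hv0 i x)
    · by_cases hx : v i x = 0
      · simp only [hx, mul_zero]
        positivity
      · have hxe : 0 < inner ℝ x e := by
          by_contra hcon
          exact hx (if_neg hcon)
        have hvx : ∀ j, max (-diff e U j x) 0 = v j x := fun j => (halfNeg_of_pos hxe).symm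
        have habs : |diff e U i x| = v i x := by
          have hlt : diff e U i x < 0 := by
            by_contra hcon
            refine hx ?_
            rw [← hvx i, max_eq_right]
            linarith
          rw [abs_of_neg hlt, ← hvx i, max_eq_left]
          linarith
        have h3 : ∀ j, v j x * v i x ≤ 1 / 2 * v i x ^ 2 + 1 / 2 * v j x ^ 2 := fun j => by
          nlinarith [sq_nonneg (v i x - v j x)]
        have h4 := Finset.sum_le_sum fun j (_ : j ∈ Finset.univ) => h3 j
        rw [Finset.sum_add_distrib, ← Finset.mul_sum, ← Finset.mul_sum, ← Finset.sum_mul, Finset.sum_const,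
          Finset.card_univ, Fintype.card_fin, nsmul_eq_mul] at h4
        simp only [hvx, habs]
        rw [add_mul]
        linarith
  have h3 : ∀ i, (2 * L * (1 + m) + 1) * ∫ x, v i x ^ 2 ≤
      2 * (L * ((1 + m / 2) * (∫ x, v i x ^ 2) + 1 / 2 * ∑ j, ∫ x, v j x ^ 2)) := fun i => by
    have ha := hP O hO hOδ (v i) (hvmem i) (hvO i)
    have hc := mul_le_mul_of_nonneg_left (h2 i) hL
    rw [hb] at ha
    linarith [h1 i]
  obtain ⟨S, hS⟩ : ∃ S, ∑ j, ∫ x, v j x ^ 2 = S := ⟨_, rfl⟩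
  have h4 := Finset.sum_le_sum fun i (_ : i ∈ Finset.univ) => h3 i
  rw [← Finset.mul_sum, ← Finset.mul_sum, ← Finset.mul_sum, Finset.sum_add_distrib,
    ← Finset.mul_sum, hS, Finset.sum_const, Finset.card_univ, Fintype.card_fin,
    nsmul_eq_mul] at h4
  have hS0 : S ≤ 0 := by linarith
  have hint : ∀ i, 0 ≤ ∫ x, v i x ^ 2 := fun i => integral_nonneg fun x => sq_nonneg _
  intro x hx i
  by_contra hneg
  have hi : ∫ x, v i x ^ 2 ≤ 0 := by
    have := Finset.single_le_sum (f := fun i => ∫ x, v i x ^ 2) (fun i _ => hint i)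
      (Finset.mem_univ i)
    rw [hS] at this
    exact this.trans hS0
  refine absurd hi (not_le.2 ?_)
  rw [integral_pos_iff_support_of_nonneg (fun x => sq_nonneg _) (hsq i)]
  have ho : IsOpen {x : Euc N | 0 < inner ℝ x e ∧ diff e U i x < 0} :=
    (isOpen_lt_inner e 0).inter (isOpen_lt (h.continuous_diff i) continuous_const)
  refine (ho.measure_pos volume ⟨x, hx, not_le.1 hneg⟩).trans_le (measure_mono fun y hy => ?_)
  have : 0 < v i y := by
    simp only [hv, halfNeg_of_pos hy.1]
    exact lt_max_of_lt_left (by linarith [hy.2])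
  exact (pow_pos this 2).ne'

end IsCooperativeSolution

end System

/-! ### Domination, and how it varies with the direction. -/

section System

open Filter Topology

variable {N m : ℕ} {k₀ : ℝ≥0 → ℝ≥0∞} {Ω : Set (Euc N)} {F : Fin m → ℝ → (Fin m → ℝ) → ℝ}
  {U : Euc N → Fin m → ℝ} {e : Euc N}

/-- In polar coordinates the half-domain is the product of an interval of radii with the directions
in a half-space; it is the image of a connected set under `(r, y) ↦ r y / |y|`. -/
lemma IsBoundedRadialDomain.isPreconnected_half (hΩ : IsBoundedRadialDomain Ω) (e : Euc N) :
    IsPreconnected {x | x ∈ Ω ∧ 0 < inner ℝ x e} := by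
  have hJ : IsPreconnected ((norm '' Ω) ∩ Ioi (0 : ℝ)) := by
    have h1 : IsPreconnected (norm '' Ω) :=
      hΩ.isConnected.isPreconnected.image _ continuous_norm.continuousOn
    exact (h1.ordConnected.inter ordConnected_Ioi).isPreconnected
  have hH : IsPreconnected {x : Euc N | 0 < inner ℝ x e} := by
    refine Convex.isPreconnected ?_
    intro x hx y hy a b ha hb hab
    simp only [mem_ofPred_eq, inner_add_left, real_inner_smul_left] at hx hy ⊢
    rcases ha.eq_or_lt with rfl | ha
    · have : b = 1 := by linarith
      simpa [this] using hy
    · have := mul_pos ha hx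
      have := mul_nonneg hb hy.le
      linarith
  have hne : ∀ x : Euc N, 0 < inner ℝ x e → ‖x‖ ≠ 0 := fun x hx h => by
    rw [norm_eq_zero.1 h, inner_zero_left] at hx
    exact lt_irrefl _ hx
  have himg : {x | x ∈ Ω ∧ 0 < inner ℝ x e} =
      (fun q : ℝ × Euc N => (q.1 / ‖q.2‖) • q.2) ''
        (((norm '' Ω) ∩ Ioi (0 : ℝ)) ×ˢ {x : Euc N | 0 < inner ℝ x e}) := by
    ext x
    constructor
    · rintro ⟨hx, hxe⟩
      have h0 := hne x hxe
      refine ⟨(‖x‖, x), ⟨⟨⟨x, hx, rfl⟩, (norm_nonneg x).lt_of_ne' h0⟩, hxe⟩, ?_⟩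
      simp [div_self h0]
    · rintro ⟨⟨r, y⟩, ⟨⟨⟨x', hx', hr⟩, hr0⟩, hy⟩, rfl⟩
      have h0 := hne y hy
      have hr0' : (0 : ℝ) < r := hr0
      have hy0 : 0 < ‖y‖ := (norm_nonneg y).lt_of_ne' h0
      refine ⟨hΩ.radial x' hx' _ ?_, ?_⟩
      · simp only at hr
        rw [hr, norm_smul, Real.norm_of_nonneg (by positivity), div_mul_cancel₀ _ h0]
      · rw [real_inner_smul_left]
        exact mul_pos (by positivity) hy
  rw [himg]
  refine (hJ.prod hH).image _ (ContinuousOn.smul (ContinuousOn.div continuousOn_fst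
    continuousOn_snd.norm fun q hq => hne _ hq.2) continuousOn_snd)

lemma IsBoundedRadialDomain.exists_mem_half (hΩ : IsBoundedRadialDomain Ω) (he : e ≠ 0) :
    ∃ x ∈ Ω, 0 < inner ℝ x e := by
  have hepos : 0 < ‖e‖ := norm_pos_iff.2 he
  obtain ⟨y, hy, hy0⟩ : ∃ y ∈ Ω, y ≠ 0 := by
    obtain ⟨y, hy⟩ := hΩ.isConnected.nonempty
    by_cases h : y = 0
    · subst h
      obtain ⟨s, hs, hsub⟩ := Metric.isOpen_iff.1 hΩ.isOpen 0 hy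
      refine ⟨(s / 2 / ‖e‖) • e, hsub ?_, smul_ne_zero (by positivity) he⟩
      rw [mem_ball_zero_iff, norm_smul, Real.norm_of_nonneg (by positivity),
        div_mul_cancel₀ _ hepos.ne']
      linarith
    · exact ⟨y, hy, h⟩
  have hypos : 0 < ‖y‖ := norm_pos_iff.2 hy0
  refine ⟨(‖y‖ / ‖e‖) • e, hΩ.radial y hy _ ?_, ?_⟩
  · rw [norm_smul, Real.norm_of_nonneg (by positivity), div_mul_cancel₀ _ hepos.ne']
  · rw [real_inner_smul_left, real_inner_self_eq_norm_sq]
    positivity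

/-- `U` dominates its reflection in the half-space `{x · e > 0}`. -/
def Dominates (e : Euc N) (U : Euc N → Fin m → ℝ) : Prop :=
  ∀ x, 0 < inner ℝ x e → ∀ i, 0 ≤ diff e U i x

/-- `U` strictly dominates its reflection in the part of `Ω` in the half-space `{x · e > 0}`. -/
def StrictlyDominates (Ω : Set (Euc N)) (e : Euc N) (U : Euc N → Fin m → ℝ) : Prop :=
  ∀ x ∈ Ω, 0 < inner ℝ x e → ∀ i, 0 < diff e U i x

/-- The condition that the system is fully coupled along `U`. -/
def IsFullyCoupled (Ω : Set (Euc N)) (F : Fin m → ℝ → (Fin m → ℝ) → ℝ) (U : Euc N → Fin m → ℝ) :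
    Prop :=
  (∀ i j, i ≠ j → ∀ r : ℝ, 0 < r → ∀ u, 0 < partialU F i j r u) ∨
    ((∀ x ∈ Ω, ∀ i, 0 < U x i) ∧
      ∀ i j, i ≠ j → ∀ r : ℝ, 0 < r → ∀ u : Fin m → ℝ, (∀ l, 0 < u l) → 0 < partialU F i j r u)

namespace IsCooperativeSolution

lemma dominates_of_strictlyDominates (h : IsCooperativeSolution k₀ Ω F U)
    (hs : StrictlyDominates Ω e U) : Dominates e U := fun x hxe i => by
  by_cases hx : x ∈ Ω
  · exact (hs x hx hxe i).le
  · exact (h.diff_eq_zero hx).ge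

lemma continuousAt_diff (h : IsCooperativeSolution k₀ Ω F U) (he : e ≠ 0) (i : Fin m) (x : Euc N) :
    ContinuousAt (fun q : Euc N × Euc N => diff q.1 U i q.2) (e, x) := by
  have h1 : ContinuousAt (fun q : Euc N × Euc N => reflection q.1 q.2) (e, x) := by
    simp only [reflection_apply]
    have h0 : ContinuousAt
        (fun q : Euc N × Euc N => 2 * inner ℝ q.2 q.1 / ‖q.1‖ ^ 2) (e, x) :=
      ContinuousAt.div (by fun_prop) (by fun_prop) (by simpa using he)
    exact continuousAt_snd.sub (h0.smul continuousAt_fst)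
  exact ((h.continuous_apply i).continuousAt.comp continuousAt_snd).sub
    ((h.continuous_apply i).continuousAt.comp h1)

/-- Domination is a closed condition on the direction. -/
lemma dominates_of_mem_closure (h : IsCooperativeSolution k₀ Ω F U) {s : Set (Euc N)}
    (hs : ∀ e' ∈ s, Dominates e' U) (he : e ≠ 0) (hes : e ∈ closure s) : Dominates e U := by
  intro x hxe i
  by_contra hneg
  have h1 : ∀ᶠ e' in 𝓝 e, 0 < inner ℝ x e' :=
    continuousAt_const.eventually_lt (f := fun _ : Euc N => (0 : ℝ))
      (g := fun e' : Euc N => inner ℝ x e') (by fun_prop) hxe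
  have h2 : ∀ᶠ e' in 𝓝 e, diff e' U i x < 0 := by
    have hcomp : ContinuousAt (fun e' : Euc N => diff e' U i x) e :=
      ContinuousAt.comp (f := fun e' : Euc N => (e', x)) (h.continuousAt_diff he i x)
        (by fun_prop)
    exact hcomp.eventually_lt continuousAt_const (not_le.1 hneg)
  obtain ⟨e', hes', h1', h2'⟩ := ((mem_closure_iff_frequently.1 hes).and_eventually
    (h1.and h2)).exists
  exact absurd (hs e' hes' x h1' i) (not_le.2 h2')

variable [Nontrivial (Euc N)]

/-- The strong maximum principle for a component of the difference of `U` and its reflection. -/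
lemma pos_of_dominates (h : IsCooperativeSolution k₀ Ω F U) (he : e ≠ 0) (hd : Dominates e U)
    {i : Fin m} {x₁ : Euc N} (hx₁ : x₁ ∈ Ω) (hx₁e : 0 < inner ℝ x₁ e) (hpos : 0 < diff e U i x₁) :
    ∀ x ∈ Ω, 0 < inner ℝ x e → 0 < diff e U i x := by
  obtain ⟨L, hL, hLB⟩ := h.exists_le_bilin_diff
  have hwc := h.continuous_diff (e := e) i
  have ho : IsOpen {x : Euc N | 0 < inner ℝ x e ∧ 0 < diff e U i x} :=
    (isOpen_lt_inner e 0).inter (isOpen_lt continuous_const hwc)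
  -- The positivity set is open, and the local strong maximum principle makes it relatively closed
  -- in the connected half-domain.
  have hsub := (h.domain.isPreconnected_half e).subset_of_closure_inter_subset ho
    ⟨x₁, ⟨hx₁, hx₁e⟩, hx₁e, hpos⟩ ?_
  · exact fun x hx hxe => (hsub ⟨hx, hxe⟩).2
  rintro x₀ ⟨hcl, hx₀, hx₀e⟩
  refine ⟨hx₀e, pos_of_forall_exists_pos h.kernelProfile h.domain.isBounded h.domain.isOpen
    (fun _ hx => h.domain.reflection_mem hx) he (h.memEnergySpace_diff e i) hwc
    (diff_reflection i) (fun x hxe => hd x hxe i) hL (fun v hv hv0 hvs => ?_) hx₀ hx₀e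
    fun η hη => ?_⟩
  · have h1 := hLB e i v hv hv0
    -- Under domination the coupling terms vanish on the support of `v`, leaving a scalar inequality
    -- for the `i`-th difference.
    have h2 : ∫ x, (|diff e U i x| + ∑ j, max (-diff e U j x) 0) * v x =
        ∫ x, diff e U i x * v x := by
      refine integral_congr_ae (.of_forall fun x => ?_)
      by_cases hx : v x = 0
      · simp [hx]
      · have hxe := hvs x hx
        have h3 : ∀ j, max (-diff e U j x) 0 = 0 := fun j =>
          max_eq_right (by linarith [hd x hxe j])
        simp [h3, abs_of_nonneg (hd x hxe i)]
    rwa [h2] at h1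
  · obtain ⟨y, hy, hyd⟩ := Metric.mem_closure_iff.1 hcl η hη
    refine ⟨y, ?_, hy⟩
    rwa [dist_comm, dist_eq_norm] at hyd

/-- If one difference has a zero in the half-domain, it vanishes everywhere, and so does the left
side of its weak equation. The right side, tested with a bump, is positive because the coupling
transmits the strict positivity of the `i`-th difference. -/
lemma strictlyDominates_of_dominates (h : IsCooperativeSolution k₀ Ω F U)
    (hc : IsFullyCoupled Ω F U) (he : e ≠ 0) (hd : Dominates e U)
    (hpos : ∃ i, ∃ x ∈ Ω, 0 < inner ℝ x e ∧ 0 < diff e U i x) : StrictlyDominates Ω e U := by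
  obtain ⟨i, x₁, hx₁, hx₁e, hx₁pos⟩ := hpos
  have hi := h.pos_of_dominates he hd hx₁ hx₁e hx₁pos
  intro x hx hxe j
  by_contra hneg
  have hj0 : ∀ y ∈ Ω, 0 < inner ℝ y e → diff e U j y = 0 := fun y hy hye => by
    by_contra hne
    exact hneg (h.pos_of_dominates he hd hy hye ((hd y hye j).lt_of_ne' hne) x hx hxe)
  have hzero : ∀ y, diff e U j y = 0 := by
    have key : ∀ y, 0 < inner ℝ y e → diff e U j y = 0 := fun y hye => by
      by_cases hy : y ∈ Ω
      · exact hj0 y hy hye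
      · exact h.diff_eq_zero hy
    intro y
    rcases lt_trichotomy 0 (inner ℝ y e) with hy | hy | hy
    · exact key y hy
    · simp [diff, reflection_eq_self hy.symm]
    · have := key (reflection e y) (by rw [inner_reflection]; linarith)
      rw [diff_reflection] at this
      linarith
  have hrhs : ∀ y ∈ Ω, 0 < inner ℝ y e → 0 < rhsDiff F e U j y := by
    intro y hy hye
    have hr : 0 < ‖y‖ := norm_pos_iff.2 fun h0 => by simp [h0] at hye
    refine sub_pos.2 (lt_of_le_of_eq_of_lt h.contDiffOn h.cooperative hr.le (i := i)
      (fun l => sub_nonneg.1 (hd y hye l)) (sub_eq_zero.1 (hzero y)).symm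
      (sub_pos.1 (hi y hy hye)) fun t ht => ?_)
    have hij : i ≠ j := by
      rintro rfl
      exact (hi y hy hye).ne' (hzero y)
    rcases hc with hc | ⟨hU, hc⟩
    · exact hc i j hij _ hr _
    · refine hc i j hij _ hr _ fun l => ?_
      have hl := hU _ (h.domain.reflection_mem (e := e) hy)
      by_cases hli : l = i
      · subst hli
        simpa using (hl l).trans_le ht
      · simpa [hli] using hl l
  obtain ⟨ρ, hρ, hρ1, hB⟩ : ∃ ρ > 0, ρ ≤ 1 ∧
      ∀ y ∈ Metric.ball x ρ, y ∈ Ω ∧ 0 < inner ℝ y e := by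
    have ho : IsOpen {y : Euc N | y ∈ Ω ∧ 0 < inner ℝ y e} :=
      h.domain.isOpen.inter (isOpen_lt_inner e 0)
    obtain ⟨s, hs, hsub⟩ := Metric.isOpen_iff.1 ho x ⟨hx, hxe⟩
    exact ⟨min s 1, by positivity, min_le_right _ _,
      fun y hy => hsub (Metric.ball_subset_ball (min_le_left _ _) hy)⟩
  have hf : MemEnergySpace k₀ Ω (bump x ρ) :=
    memEnergySpace_bump h.kernelProfile hρ hρ1 fun y hy => (hB y hy).1
  have h1 := h.bilin_diff e j hf
  have h2 : bilin k₀ (diff e U j) (bump x ρ) = 0 := by simp [bilin_eq, hzero]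
  have h3 : 0 < ∫ y in Ω, rhsDiff F e U j y * bump x ρ y := by
    rw [integral_pos_iff_support_of_nonneg _ (h.integrableOn_mul (h.continuous_rhsDiff j) hf)]
    · refine (Metric.measure_ball_pos volume x hρ).trans_le ?_
      rw [← Measure.restrict_eq_self volume (show Metric.ball x ρ ⊆ Ω from fun y hy => (hB y hy).1)]
      exact measure_mono fun y hy => (mul_pos (hrhs y (hB y hy).1 (hB y hy).2) (bump_pos hρ hy)).ne'
    · intro y
      by_cases hy : y ∈ Metric.ball x ρ
      · exact (mul_pos (hrhs y (hB y hy).1 (hB y hy).2) (bump_pos hρ hy)).le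
      · simp [bump_eq_zero hρ hy]
  linarith

/-- Strict domination is an open condition on the direction. -/
lemma eventually_strictlyDominates (h : IsCooperativeSolution k₀ Ω F U)
    (hc : IsFullyCoupled Ω F U) (i₀ : Fin m) (he : e ≠ 0) (hs : StrictlyDominates Ω e U) :
    ∀ᶠ e' in 𝓝 e, StrictlyDominates Ω e' U := by
  obtain ⟨δ, hδ, hsm⟩ := h.exists_small_measure
  have hΩm := h.domain.isOpen.measurableSet
  have hΩf : volume Ω ≠ ∞ := h.domain.isBounded.measure_lt_top.ne
  -- The hyperplane has measure zero, so a compact `K` avoiding it can exhaust `Ω` up to measure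
  -- `δ`.
  have hZ : volume {x : Euc N | inner ℝ x e = 0} = 0 := by
    have : {x : Euc N | inner ℝ x e = 0} = ((Submodule.span ℝ {e})ᗮ : Submodule ℝ (Euc N)) := by
      ext x
      simp [Submodule.mem_orthogonal_singleton_iff_inner_left]
    rw [this]
    refine Measure.addHaar_submodule _ _ fun htop => he ?_
    have : e ∈ (Submodule.span ℝ {e})ᗮ := htop ▸ Submodule.mem_top
    simpa [Submodule.mem_orthogonal_singleton_iff_inner_left] using this
  have hSm : MeasurableSet {x | x ∈ Ω ∧ inner ℝ x e ≠ 0} :=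
    (h.domain.isOpen.inter (isOpen_ne_fun (f := fun x : Euc N => (inner ℝ x e : ℝ)) (g := fun _ => 0)
      (by fun_prop) (by fun_prop))).measurableSet
  have hSf : volume {x | x ∈ Ω ∧ inner ℝ x e ≠ 0} ≠ ∞ :=
    ((measure_mono fun x hx => hx.1).trans_lt hΩf.lt_top).ne
  obtain ⟨K, hKS, hKc, hKδ⟩ := hSm.exists_isCompact_sdiff_lt hSf hδ
  have hO : volume (Ω \ K) ≤ δ := by
    have hsub : Ω \ K ⊆ ({x | x ∈ Ω ∧ inner ℝ x e ≠ 0} \ K) ∪ {x : Euc N | inner ℝ x e = 0} := by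
      rintro x ⟨hx, hxK⟩
      by_cases h0 : inner ℝ x e = 0
      · exact .inr h0
      · exact .inl ⟨⟨hx, h0⟩, hxK⟩
    refine (measure_mono hsub).trans ((measure_union_le _ _).trans ?_)
    rw [hZ, add_zero]
    exact hKδ.le
  -- By compactness one neighbourhood of `e` serves all of `K`. On the side `x · e < 0` the claim is
  -- void for nearby `e'`.
  have hK : ∀ᶠ e' in 𝓝 e, ∀ x ∈ K, 0 < inner ℝ x e' → ∀ i, 0 < diff e' U i x := by
    refine hKc.eventually_forall_of_forall_eventually fun x hx => ?_
    have hin : ContinuousAt (fun q : Euc N × Euc N => (inner ℝ q.2 q.1 : ℝ)) (e, x) := by fun_prop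
    rcases lt_or_gt_of_ne (hKS hx).2 with hxe | hxe
    · filter_upwards [hin.eventually_lt continuousAt_const hxe] with q hq hq'
      exact absurd hq' hq.not_gt
    · have : ∀ i, ∀ᶠ q : Euc N × Euc N in 𝓝 (e, x), 0 < diff q.1 U i q.2 := fun i =>
        continuousAt_const.eventually_lt (h.continuousAt_diff he i x) (hs x (hKS hx).1 hxe i)
      filter_upwards [eventually_all.2 this] with q hq _ using hq
  -- The small-measure principle yields only weak domination for `e'`; the point `x₁` makes it
  -- strict.
  obtain ⟨x₁, hx₁, hx₁e⟩ := h.domain.exists_mem_half he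
  have h1 : ∀ᶠ e' in 𝓝 e, 0 < inner ℝ x₁ e' :=
    continuousAt_const.eventually_lt (f := fun _ : Euc N => (0 : ℝ))
      (g := fun e' : Euc N => inner ℝ x₁ e') (by fun_prop) hx₁e
  have h2 : ∀ᶠ e' in 𝓝 e, 0 < diff e' U i₀ x₁ := by
    have hcomp : ContinuousAt (fun e' : Euc N => diff e' U i₀ x₁) e :=
      ContinuousAt.comp (f := fun e' : Euc N => (e', x₁)) (h.continuousAt_diff he i₀ x₁)
        (by fun_prop)
    exact continuousAt_const.eventually_lt hcomp (hs x₁ hx₁ hx₁e i₀)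
  filter_upwards [hK, h1, h2, isOpen_ne.mem_nhds he] with e' hK' h1' h2' he'
  refine h.strictlyDominates_of_dominates hc he' ?_ ⟨i₀, x₁, hx₁, h1', h2'⟩
  refine hsm e' (Ω \ K) (hΩm.diff hKc.measurableSet) hO fun x hx hxe i => ?_
  by_cases hxΩ : x ∈ Ω
  · have hxK : x ∈ K := by
      by_contra hxK
      exact hx ⟨hxΩ, hxK⟩
    exact (hK' x hxK hxe i).le
  · exact (h.diff_eq_zero hxΩ).ge

end IsCooperativeSolution

end System

/-! ### The first moment as axis, and the passage to symmetry. -/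

section Symmetry

open Filter Topology

variable {N m : ℕ} {k₀ : ℝ≥0 → ℝ≥0∞} {Ω : Set (Euc N)} {F : Fin m → ℝ → (Fin m → ℝ) → ℝ}
  {U : Euc N → Fin m → ℝ} {e : Euc N}

/-- The first moment of a component of `U`. -/
def moment (U : Euc N → Fin m → ℝ) (i : Fin m) : Euc N := ∫ x, U x i • x

/-- For equal norms, `x · (x - y) = |x - y|² / 2`. -/
lemma inner_sub_pos {x y : Euc N} (hxy : ‖x‖ = ‖y‖) (hne : x - y ≠ 0) :
    0 < inner ℝ x (x - y) := by
  have h1 := norm_sub_sq_real x y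
  have h2 : 0 < ‖x - y‖ := norm_pos_iff.2 hne
  rw [inner_sub_right, real_inner_self_eq_norm_sq]
  rw [← hxy] at h1
  nlinarith

namespace IsCooperativeSolution

lemma hasCompactSupport (h : IsCooperativeSolution k₀ Ω F U) (i : Fin m) :
    HasCompactSupport fun x => U x i := by
  obtain ⟨R, hR⟩ := h.domain.isBounded.subset_closedBall 0
  refine .of_support_subset_isCompact (isCompact_closedBall (0 : Euc N) R) fun x hx => ?_
  by_contra hxR
  exact hx ((h.solution.mem i).zero_outside x fun hxΩ => hxR (hR hxΩ))

lemma integrable_mul_inner (h : IsCooperativeSolution k₀ Ω F U) (i : Fin m) (e : Euc N) :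
    Integrable fun x => U x i * inner ℝ x e :=
  ((h.continuous_apply i).mul (by fun_prop)).integrable_of_hasCompactSupport
    (h.hasCompactSupport i).mul_right

lemma inner_moment (h : IsCooperativeSolution k₀ Ω F U) (i : Fin m) (e : Euc N) :
    inner ℝ e (moment U i) = ∫ x, U x i * inner ℝ x e := by
  have hi : Integrable fun x => U x i • x :=
    ((h.continuous_apply i).smul continuous_id).integrable_of_hasCompactSupport
      (h.hasCompactSupport i).smul_right
  rw [moment, ← integral_inner hi]
  exact integral_congr_ae (.of_forall fun x => by
    simp only [real_inner_smul_right, real_inner_comm])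

lemma integrable_diff_mul_inner (h : IsCooperativeSolution k₀ Ω F U) (i : Fin m) (e : Euc N) :
    Integrable fun x => diff e U i x * inner ℝ x e := by
  have h1 := (measurePreserving_reflection e).integrable_comp_of_integrable
    (h.integrable_mul_inner i e)
  refine ((h.integrable_mul_inner i e).add h1).congr (.of_forall fun x => ?_)
  simp only [Function.comp_def, Pi.add_apply, inner_reflection, diff]
  ring

/-- The substitution `x ↦ σ_e x` changes the sign of `x · e`; averaging the two expressions for `e ·
M` produces the difference. -/
lemma two_mul_inner_moment (h : IsCooperativeSolution k₀ Ω F U) (i : Fin m) (e : Euc N) :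
    2 * inner ℝ e (moment U i) = ∫ x, diff e U i x * inner ℝ x e := by
  have h1 := (measurePreserving_reflection e).integrable_comp_of_integrable
    (h.integrable_mul_inner i e)
  simp only [Function.comp_def] at h1
  have h2 := (measurePreserving_reflection e).integral_comp
    (reflection e).toHomeomorph.measurableEmbedding fun x => U x i * inner ℝ x e
  rw [h.inner_moment, two_mul]
  nth_rewrite 2 [← h2]
  rw [← integral_add (h.integrable_mul_inner i e) h1]
  refine integral_congr_ae (.of_forall fun x => ?_)
  simp only [inner_reflection, diff]
  ring

lemma inner_moment_pos (h : IsCooperativeSolution k₀ Ω F U) (he : e ≠ 0)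
    (hs : StrictlyDominates Ω e U) (i : Fin m) : 0 < inner ℝ e (moment U i) := by
  have hd := h.dominates_of_strictlyDominates hs
  suffices 0 < ∫ x, diff e U i x * inner ℝ x e by
    rw [← h.two_mul_inner_moment] at this
    linarith
  rw [integral_pos_iff_support_of_nonneg _ (h.integrable_diff_mul_inner i e)]
  · obtain ⟨x₁, hx₁, hx₁e⟩ := h.domain.exists_mem_half he
    have ho : IsOpen {y : Euc N | y ∈ Ω ∧ 0 < inner ℝ y e} :=
      h.domain.isOpen.inter (isOpen_lt_inner e 0)
    exact (ho.measure_pos volume ⟨x₁, hx₁, hx₁e⟩).trans_le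
      (measure_mono fun y hy => (mul_pos (hs y hy.1 hy.2 i) hy.2).ne')
  · intro x
    rcases lt_trichotomy 0 (inner ℝ x e) with hx | hx | hx
    · exact mul_nonneg (hd x hx i) hx.le
    · simp [← hx]
    · have := hd (reflection e x) (by rw [inner_reflection]; linarith) i
      rw [diff_reflection] at this
      exact mul_nonneg_of_nonpos_of_nonpos (by linarith) hx.le

/-- Strict domination in all directions of an open half-space gives strict monotonicity on
spheres. -/
lemma lt_of_inner_lt {p : Euc N} (hp : ∀ e, 0 < inner ℝ e p → StrictlyDominates Ω e U)
    {x y : Euc N} (hx : x ∈ Ω) (hxy : ‖x‖ = ‖y‖) (hlt : inner ℝ y p < inner ℝ x p) (i : Fin m) :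
    U y i < U x i := by
  have hpos : 0 < inner ℝ (x - y) p := by
    rw [inner_sub_left]
    linarith
  have hne : x - y ≠ 0 := by
    intro h0
    simp [h0] at hpos
  have h1 := hp _ hpos x hx (inner_sub_pos hxy hne) i
  have h2 : reflection (x - y) x = y := Submodule.reflection_sub hxy
  rw [diff, h2] at h1
  linarith

/-- When `x - y` is orthogonal to `p` it is still a limit of the admissible directions `x - y + s p`
as `s → 0⁺`, and domination passes to the limit. -/
lemma le_of_inner_le (h : IsCooperativeSolution k₀ Ω F U) {p : Euc N} (hp0 : p ≠ 0)
    (hp : ∀ e, 0 < inner ℝ e p → StrictlyDominates Ω e U)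
    {x y : Euc N} (hxy : ‖x‖ = ‖y‖) (hle : inner ℝ y p ≤ inner ℝ x p) (i : Fin m) :
    U y i ≤ U x i := by
  by_cases hne : x - y = 0
  · rw [sub_eq_zero.1 hne]
  have hcl : x - y ∈ closure {e : Euc N | 0 < inner ℝ e p} := by
    have ht : Tendsto (fun s : ℝ => x - y + s • p) (𝓝[>] 0) (𝓝 (x - y)) := by
      have : Continuous fun s : ℝ => x - y + s • p := by fun_prop
      simpa using (this.tendsto 0).mono_left nhdsWithin_le_nhds
    refine mem_closure_of_tendsto ht ?_
    filter_upwards [self_mem_nhdsWithin] with s (hs : 0 < s)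
    have : 0 < ‖p‖ := norm_pos_iff.2 hp0
    rw [inner_add_left, inner_sub_left, real_inner_smul_left,
      real_inner_self_eq_norm_sq]
    have : 0 < s * ‖p‖ ^ 2 := by positivity
    linarith
  have hd := h.dominates_of_mem_closure
    (fun e he => h.dominates_of_strictlyDominates (hp e he)) hne hcl
  have h1 := hd x (inner_sub_pos hxy hne) i
  have h2 : reflection (x - y) x = y := Submodule.reflection_sub hxy
  rw [diff, h2] at h1
  linarith

variable [Nontrivial (Euc N)]

/-- Were the `i`-th difference zero, `two_mul_inner_moment` would give `e · M = 0`. -/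
lemma strictlyDominates_of_inner_moment_pos (h : IsCooperativeSolution k₀ Ω F U)
    (hc : IsFullyCoupled Ω F U) (hd : Dominates e U) {i : Fin m}
    (hpos : 0 < inner ℝ e (moment U i)) : StrictlyDominates Ω e U := by
  have he : e ≠ 0 := by
    rintro rfl
    simp at hpos
  refine h.strictlyDominates_of_dominates hc he hd ?_
  by_contra! hcon
  have key : ∀ x, 0 < inner ℝ x e → diff e U i x = 0 := fun x hxe => by
    by_cases hx : x ∈ Ω
    · exact le_antisymm (hcon i x hx hxe) (hd x hxe i)
    · exact h.diff_eq_zero hx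
  have hzero : ∀ x, diff e U i x = 0 := by
    intro x
    rcases lt_trichotomy 0 (inner ℝ x e) with hx | hx | hx
    · exact key x hx
    · simp [diff, reflection_eq_self hx.symm]
    · have := key (reflection e x) (by rw [inner_reflection]; linarith)
      rw [diff_reflection] at this
      linarith
  have := h.two_mul_inner_moment i e
  simp only [hzero, zero_mul, integral_zero] at this
  linarith

/-- If `U` strictly dominates one of its reflections, then it strictly dominates all those
reflections whose direction has a positive inner product with the first moment. -/
lemma strictlyDominates_of_exists (h : IsCooperativeSolution k₀ Ω F U) (hc : IsFullyCoupled Ω F U)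
    (i : Fin m) {e₀ : Euc N} (he₀ : e₀ ≠ 0) (hs : StrictlyDominates Ω e₀ U) :
    ∀ e, 0 < inner ℝ e (moment U i) → StrictlyDominates Ω e U := by
  have hconn : IsPreconnected {e : Euc N | 0 < inner ℝ e (moment U i)} := by
    refine Convex.isPreconnected ?_
    intro x hx y hy a b ha hb hab
    simp only [mem_ofPred_eq, inner_add_left, real_inner_smul_left] at hx hy ⊢
    rcases ha.eq_or_lt with rfl | ha
    · have : b = 1 := by linarith
      simpa [this] using hy
    · have := mul_pos ha hx
      have := mul_nonneg hb hy.le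
      linarith
  have ho : IsOpen {e : Euc N | e ≠ 0 ∧ StrictlyDominates Ω e U} := by
    rw [isOpen_iff_mem_nhds]
    rintro e ⟨he, hse⟩
    filter_upwards [isOpen_ne.mem_nhds he, h.eventually_strictlyDominates hc i he hse] with
      e' h1 h2 using ⟨h1, h2⟩
  -- Continuity argument over a whole half-space of directions, not normalized to length one; `e₀`
  -- belongs to it by `inner_moment_pos`.
  have hsub := hconn.subset_of_closure_inter_subset ho
    ⟨e₀, h.inner_moment_pos he₀ hs i, he₀, hs⟩ ?_
  · exact fun e he => (hsub he).2
  rintro e ⟨hcl, hpos⟩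
  have he : e ≠ 0 := by
    rintro rfl
    simp at hpos
  exact ⟨he, h.strictlyDominates_of_inner_moment_pos hc (h.dominates_of_mem_closure
    (fun e' he' => h.dominates_of_strictlyDominates he'.2) he hcl) hpos⟩

end IsCooperativeSolution

lemma inner_le_of_angle_le {x y p : Euc N} (hxy : ‖x‖ = ‖y‖)
    (h : InnerProductGeometry.angle x p ≤ InnerProductGeometry.angle y p) :
    inner ℝ y p ≤ inner ℝ x p := by
  rw [← InnerProductGeometry.cos_angle_mul_norm_mul_norm x p,
    ← InnerProductGeometry.cos_angle_mul_norm_mul_norm y p, hxy]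
  exact mul_le_mul_of_nonneg_right (Real.cos_le_cos_of_nonneg_of_le_pi
    (InnerProductGeometry.angle_nonneg _ _) (InnerProductGeometry.angle_le_pi _ _) h)
    (by positivity)

lemma inner_lt_of_angle_lt {x y p : Euc N} (hxy : ‖x‖ = ‖y‖) (hx : x ≠ 0) (hp : p ≠ 0)
    (h : InnerProductGeometry.angle x p < InnerProductGeometry.angle y p) :
    inner ℝ y p < inner ℝ x p := by
  have hx0 : 0 < ‖x‖ := norm_pos_iff.2 hx
  have hp0 : 0 < ‖p‖ := norm_pos_iff.2 hp
  rw [← InnerProductGeometry.cos_angle_mul_norm_mul_norm x p,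
    ← InnerProductGeometry.cos_angle_mul_norm_mul_norm y p, ← hxy]
  exact mul_lt_mul_of_pos_right (Real.cos_lt_cos_of_nonneg_of_le_pi
    (InnerProductGeometry.angle_nonneg _ _) (InnerProductGeometry.angle_le_pi _ _) h)
    (by positivity)

/-- A continuous function that is monotone in the polar angle is foliated Schwarz symmetric. -/
lemma isFoliatedSchwarz_of_forall_le {u : Euc N → ℝ} (hu : Continuous u) {p : Euc N} (hp : p ≠ 0)
    (hmono : ∀ x y, ‖x‖ = ‖y‖ → inner ℝ y p ≤ inner ℝ x p → u y ≤ u x) :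
    IsFoliatedSchwarz Ω p u := by
  intro r hr _ c
  -- The full sphere is itself a closed geodesic ball, of radius `π r`, so this alternative always
  -- holds.
  right
  have hc : IsCompact {x : Euc N | ‖x‖ = r ∧ c ≤ u x} := by
    refine (isCompact_sphere (0 : Euc N) r).of_isClosed_subset
      ((isClosed_eq continuous_norm continuous_const).inter
        (isClosed_le continuous_const hu)) fun x hx => ?_
    simpa using hx.1
  rcases eq_empty_or_nonempty {x : Euc N | ‖x‖ = r ∧ c ≤ u x} with hS | hS
  · refine ⟨0, le_rfl, .inl ?_⟩
    rw [hS, eq_comm, eq_empty_iff_forall_notMem]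
    rintro x ⟨-, hx⟩
    exact absurd hx (not_lt.2 (mul_nonneg hr.le (InnerProductGeometry.angle_nonneg _ _)))
  -- A point of the superlevel set farthest from the axis, which exists by compactness, determines
  -- the radius of the closed ball.
  · obtain ⟨y, ⟨hyr, hyc⟩, hmin⟩ := hc.exists_isMinOn hS
      (f := fun x => inner ℝ x p) (by fun_prop)
    have hy0 : y ≠ 0 := by
      rintro rfl
      simp at hyr
      exact hr.ne hyr
    refine ⟨r * InnerProductGeometry.angle y p,
      mul_nonneg hr.le (InnerProductGeometry.angle_nonneg _ _), .inr ?_⟩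
    ext x
    simp only [mem_ofPred_eq, mul_le_mul_iff_right₀ hr, and_congr_right_iff]
    intro hxr
    constructor
    · intro hx
      by_contra hlt
      have h1 := inner_lt_of_angle_lt (hyr.trans hxr.symm) hy0 hp (not_le.1 hlt)
      exact absurd (hmin ⟨hxr, hx⟩) (not_le.2 h1)
    · intro hx
      exact hyc.trans (hmono x y (hxr.trans hyr.symm)
        (inner_le_of_angle_le (hxr.trans hyr.symm) hx))

end Symmetry

end

end NonlocalSystem

/-! ### The main theorem. -/

theorem theorem1p1 {N m : ℕ} (hN : 2 ≤ N)
    (k₀ : ℝ≥0 → ℝ≥0∞) (hk : NonlocalSystem.IsKernelProfile N k₀)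
    (Ω : Set (EuclideanSpace ℝ (Fin N))) (hΩ : NonlocalSystem.IsBoundedRadialDomain Ω)
    (F : Fin m → ℝ → (Fin m → ℝ) → ℝ)
    (hF : ∀ j, ContDiffOn ℝ 1 (fun q : ℝ × (Fin m → ℝ) => F j q.1 q.2) (Ici 0 ×ˢ univ))
    (hcoop : ∀ i j, i ≠ j → ∀ r : ℝ, 0 ≤ r → ∀ u, 0 ≤ NonlocalSystem.partialU F i j r u)
    (U : EuclideanSpace ℝ (Fin N) → Fin m → ℝ)
    (hcont : Continuous U) (hbdd : ∃ C : ℝ, ∀ x i, |U x i| ≤ C)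
    (hsol : NonlocalSystem.IsWeakSolution k₀ Ω F U)
    (e₀ : EuclideanSpace ℝ (Fin N)) (he₀ : ‖e₀‖ = 1)
    (hdom : ∀ x ∈ Ω, 0 < inner ℝ x e₀ → ∀ i, U (NonlocalSystem.reflect e₀ x) i ≤ U x i)
    (hstrict : ∃ i, ∃ x ∈ Ω, 0 < inner ℝ x e₀ ∧ U (NonlocalSystem.reflect e₀ x) i < U x i)
    (hcoupled :
      (∀ i j, i ≠ j → ∀ r : ℝ, 0 < r → ∀ u, 0 < NonlocalSystem.partialU F i j r u) ∨
      ((∀ x ∈ Ω, ∀ i, 0 < U x i) ∧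
        ∀ i j, i ≠ j → ∀ r : ℝ, 0 < r → ∀ u : Fin m → ℝ, (∀ l, 0 < u l) →
          0 < NonlocalSystem.partialU F i j r u)) :
    ∃ p : EuclideanSpace ℝ (Fin N), ‖p‖ = 1 ∧
      ∀ i, NonlocalSystem.IsFoliatedSchwarz Ω p (fun x => U x i) ∧
        NonlocalSystem.StrictlyDecreasingInPolarAngle Ω p (fun x => U x i) := by
  have : Nonempty (Fin N) := ⟨⟨0, by omega⟩⟩
  have hnt : Nontrivial (NonlocalSystem.Euc N) := inferInstance
  have h : NonlocalSystem.IsCooperativeSolution k₀ Ω F U :=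
    ⟨hk, hΩ, hF, hcoop, hcont, hbdd, hsol⟩
  have hne : e₀ ≠ 0 := fun h0 => by simp [h0] at he₀
  have hd : NonlocalSystem.Dominates e₀ U := fun x hxe i => by
    by_cases hx : x ∈ Ω
    · have := hdom x hx hxe i
      rw [NonlocalSystem.reflect_eq_reflection he₀] at this
      exact sub_nonneg.2 this
    · exact (h.diff_eq_zero hx).ge
  obtain ⟨i₀, x₁, hx₁, hx₁e, hlt⟩ := hstrict
  rw [NonlocalSystem.reflect_eq_reflection he₀] at hlt
  have hs := h.strictlyDominates_of_dominates hcoupled hne hd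
    ⟨i₀, x₁, hx₁, hx₁e, sub_pos.2 hlt⟩
  have hall := h.strictlyDominates_of_exists hcoupled i₀ hne hs
  set M := NonlocalSystem.moment U i₀ with hM
  have hM0 : M ≠ 0 := fun h0 => by
    have := h.inner_moment_pos hne hs i₀
    rw [← hM, h0, inner_zero_right] at this
    exact lt_irrefl _ this
  have hMpos : 0 < ‖M‖ := norm_pos_iff.2 hM0
  have hp1 : ‖(‖M‖⁻¹ • M)‖ = 1 := norm_smul_inv_norm hM0
  have hp0 : ‖M‖⁻¹ • M ≠ 0 := smul_ne_zero (inv_ne_zero hMpos.ne') hM0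
  have hp : ∀ e, 0 < inner ℝ e (‖M‖⁻¹ • M) → NonlocalSystem.StrictlyDominates Ω e U := by
    intro e he
    rw [real_inner_smul_right] at he
    exact hall e (pos_of_mul_pos_right he (by positivity))
  refine ⟨‖M‖⁻¹ • M, hp1, fun i => ⟨?_, ?_⟩⟩
  · exact NonlocalSystem.isFoliatedSchwarz_of_forall_le (h.continuous_apply i) hp0
      fun x y hxy hle => h.le_of_inner_le hp0 hp hxy hle i
  · intro x hx y hy hxy hlt
    have hx0 : x ≠ 0 := by
      rintro rfl
      have : y = 0 := by simpa using hxy.symm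
      subst this
      exact lt_irrefl _ hlt
    exact NonlocalSystem.IsCooperativeSolution.lt_of_inner_lt hp hx hxy
      (NonlocalSystem.inner_lt_of_angle_lt hxy hx0 hp0 hlt) i
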